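/- Norms are spectral norms and $\kappa(A)=\sigma_{\max}(A)/\sigma_{\min}(A)$ (with $\kappa(A)=\infty$ if $A$ does not have full column rank). Floating-point arithmetic follows the standard model with unit roundoff $\boldsymbol u>0$: every $+,-,\cdot,/,\sqrt{\ }$ returns its exact result up to a relative error at most $\boldsymbol u$ (nothing is guaranteed for a division by $0$ or the square root of a negative number). Let $\boldsymbol{\mathcal X}=[\boldsymbol X_1,\dots,\boldsymbol X_p]$ with blocks $\boldsymbol X_j\in\mathbb R^{m\times s}$, and write $\boldsymbol{\mathcal X}_k=[\boldsymbol X_1,\dots,\boldsymbol X_k]$. Given a routine $\mathtt{IO}_A$ which maps an $m\times s$ matrix to a pair $(\widehat{\boldsymbol Q},\widehat R)$ with $\widehat{\boldsymbol Q}\in\mathbb R^{m\times s}$, $\widehat R\in\mathbb R^{s\times s}$, the method BCGSI+P-1S computes $\boldsymbol{\mathcal Q}_k=[\boldsymbol Q_1,\dots,\boldsymbol Q_k]$ and the $k\times k$ block upper triangular $\mathcal R_k=(R_{ij})$ as follows: $[\boldsymbol Q_1,R_{11}]=\mathtt{IO}_A(\boldsymbol X_1)$, and for $k=1,\dots,p-1$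 - if $k=1$: $\mathcal S_{1:1,2}=\boldsymbol Q_1^\top\boldsymbol X_2$; if $k\ge2$: $\mathcal S_{1:k,k+1}=\begin{bmatrix}\boldsymbol Z_{k-1}\\ Y_{kk}^{-\top}(P_k-\mathcal Y_{1:k-1,k}^\top\boldsymbol Z_{k-1})\end{bmatrix}$, where $\boldsymbol Z_{k-1}=\boldsymbol{\mathcal Q}_{k-1}^\top\boldsymbol X_{k+1}$ and $P_k=\boldsymbol U_k^\top\boldsymbol X_{k+1}$ come from the previous step; - $T_{k+1}=\boldsymbol X_{k+1}^\top\boldsymbol X_{k+1}$, $\ S_{k+1,k+1}=\mathrm{chol}(T_{k+1}-\mathcal S_{1:k,k+1}^\top\mathcal S_{1:k,k+1})$, $\ \boldsymbol U_{k+1}=(\boldsymbol X_{k+1}-\boldsymbol{\mathcal Q}_k\mathcal S_{1:k,k+1})S_{k+1,k+1}^{-1}$; - $\mathcal Y_{1:k,k+1}=\boldsymbol{\mathcal Q}_k^\top\boldsymbol U_{k+1}$, $\ \Omega_{k+1}=\boldsymbol U_{k+1}^\top\boldsymbol U_{k+1}$, and, if $k<p-1$, $\boldsymbol Z_k=\boldsymbol{\mathcal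 Q}_k^\top\boldsymbol X_{k+2}$, $P_{k+1}=\boldsymbol U_{k+1}^\top\boldsymbol X_{k+2}$; - $Y_{k+1,k+1}=\mathrm{chol}(\Omega_{k+1}-\mathcal Y_{1:k,k+1}^\top\mathcal Y_{1:k,k+1})$, $\ \boldsymbol Q_{k+1}=(\boldsymbol U_{k+1}-\boldsymbol{\mathcal Q}_k\mathcal Y_{1:k,k+1})Y_{k+1,k+1}^{-1}$; - $\mathcal R_{1:k,k+1}=\mathcal S_{1:k,k+1}+\mathcal Y_{1:k,k+1}S_{k+1,k+1}$, $\ R_{k+1,k+1}=Y_{k+1,k+1}S_{k+1,k+1}$. Here $\mathrm{chol}(A)$ is the upper triangular Cholesky factor $R$ with $R^\top R=A$. In floating point, matrix products and the sums $C\pm AB$ are evaluated conventionally (entrywise inner products, summed in any order), $\mathrm{chol}$ by the usual entrywise algorithm on the upper triangle, and products with an inverse triangular matrix by substitution. Hats denote computed quantities. **Theorem.** For all $m,p$, all $s\ge1$ and every $c\ge0$ there is a constant $C>0$, depending only on $m,s,p,c$, such that the following holds for every $\boldsymbol u>0$, every $\boldsymbol{\mathcal X}$, every $\mathtt{IO}_A$,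 and all factors computed by BCGSI+P-1S from $\boldsymbol{\mathcal X}$ with $\mathtt{IO}_A$ in floating-point arithmetic with unit roundoff $\boldsymbol u$. Let $k\in\{1,\dots,p\}$ be such that $$C\boldsymbol u\,\kappa^2(\boldsymbol{\mathcal X}_k)\le\tfrac12,$$ and suppose that for all $\boldsymbol X\in\mathbb R^{m\times s}$ with $\kappa(\boldsymbol X)\le\kappa(\boldsymbol{\mathcal X}_k)$ the output $[\widehat{\boldsymbol Q},\widehat R]=\mathtt{IO}_A(\boldsymbol X)$ satisfies, for some $\Delta D$ and $\Delta\boldsymbol X$, $$\widehat R^\top\widehat R=\boldsymbol X^\top\boldsymbol X+\Delta D,\quad\|\Delta D\|\le c\boldsymbol u\|\boldsymbol X\|^2,$$ $$\boldsymbol X+\Delta\boldsymbol X=\widehat{\boldsymbol Q}\widehat R,\quad\|\Delta\boldsymbol X\|\le c\boldsymbol u\|\boldsymbol X\|,$$ $$\|I-\widehat{\boldsymbol Q}^\top\widehat{\boldsymbol Q}\|\le\frac{c\boldsymbol u}{1-c\boldsymbol u\,\kappa^2(\boldsymbol X)}.$$ Then there is $\Delta\boldsymbol{\mathcal X}_k$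 with $$\boldsymbol{\mathcal X}_k+\Delta\boldsymbol{\mathcal X}_k=\widehat{\boldsymbol{\mathcal Q}}_k\widehat{\mathcal R}_k,\quad\|\Delta\boldsymbol{\mathcal X}_k\|\le C\boldsymbol u\,\|\boldsymbol{\mathcal X}_k\|,\qquad\text{and}\qquad\|I-\widehat{\boldsymbol{\mathcal Q}}_k^\top\widehat{\boldsymbol{\mathcal Q}}_k\|\le C\boldsymbol u.$$ In particular, if these assumptions hold for $\boldsymbol{\mathcal X}=\boldsymbol{\mathcal X}_p$, the conclusion holds for every $k\in\{1,\dots,p\}$. -/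

import Mathlib

/-! Norms of matrices are spectral norms (operator norms for the Euclidean norms). -/
open scoped Matrix.Norms.L2Operator

namespace BlockGS

/-! ### Singular values and condition number -/

/-- The smallest singular value of a matrix with at least one column:
`σ_min(A) = min {‖A v‖₂ : ‖v‖₂ = 1}`. It is positive iff `A` has full column rank. -/
noncomputable def sigmaMin {m n : Type*} [Fintype m] [Fintype n] [DecidableEq n]
    (A : Matrix m n ℝ) : ℝ :=
  ⨅ v : Metric.sphere (0 : EuclideanSpace ℝ n) 1, ‖Matrix.toEuclideanLin A v.1‖

/-- The spectral condition number `κ(A) = σ_max(A) / σ_min(A)` of a matrix of full column rank.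
(For other matrices `κ(A) = ∞` in the usual convention; the value of this real-valued function is
then meaningless, so it is only used together with `0 < sigmaMin A`.) -/
noncomputable def condNum {m n : Type*} [Fintype m] [Fintype n] [DecidableEq n]
    (A : Matrix m n ℝ) : ℝ :=
  ‖A‖ / sigmaMin A

/-! ### Block vectors and block matrices

Blocks are numbered from `0`. -/

/-- The block row `[X₀, …, X_{k-1}]`. -/
def blockRow {m s : ℕ} (k : ℕ) (X : ℕ → Matrix (Fin m) (Fin s) ℝ) :
    Matrix (Fin m) (Fin k × Fin s) ℝ :=
  Matrix.of fun i c => X c.1 i c.2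

/-- The block column with blocks `B₀, …, B_{k-1}`. -/
def blockCol {s : ℕ} (k : ℕ) (B : ℕ → Matrix (Fin s) (Fin s) ℝ) :
    Matrix (Fin k × Fin s) (Fin s) ℝ :=
  Matrix.of fun r j => B r.1 r.2 j

/-- The leading `k × k` block matrix `(R i j)_{i, j < k}`. -/
def blockMat {s : ℕ} (k : ℕ) (R : ℕ → ℕ → Matrix (Fin s) (Fin s) ℝ) :
    Matrix (Fin k × Fin s) (Fin k × Fin s) ℝ :=
  Matrix.of fun r c => R r.1 c.1 r.2 c.2

/-! ### The standard model of floating-point arithmetic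

Every elementary operation `+, -, *, /, √` returns its exact result up to a relative error of at
most the unit roundoff `u`; the rounding errors are otherwise arbitrary. A computation is therefore
a relation between its input and its possible results. -/

/-- `y` is a possible rounding of `x`: `y = x (1 + δ)` with `|δ| ≤ u`. -/
def FlRound (u x y : ℝ) : Prop := |y - x| ≤ u * |x|

/-- `z` is a possible result of the floating-point division `a / b`.
Nothing is guaranteed about the result of a division by zero. -/
def FlDiv (u a b z : ℝ) : Prop := b ≠ 0 → FlRound u (a / b) z

/-- `z` is a possible result of the floating-point square root of `a`.
Nothing is guaranteed about the result for negative `a`. -/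
def FlSqrt (u a z : ℝ) : Prop := 0 ≤ a → FlRound u (Real.sqrt a) z

/-- `FlSum u A z`: `z` is a possible result of adding up the numbers of the nonempty multiset `A`
in floating-point arithmetic, in any order and with any bracketing. -/
inductive FlSum (u : ℝ) : Multiset ℝ → ℝ → Prop
  | single (x : ℝ) : FlSum u {x} x
  | add {A B : Multiset ℝ} {x y z : ℝ} :
      FlSum u A x → FlSum u B y → FlRound u (x + y) z → FlSum u (A + B) z

/-- `z` is a possible floating-point result of the inner product `∑ l ∈ t, a l * b l`. -/
def FlDot {ι : Type*} (u : ℝ) (t : Finset ι) (a b : ι → ℝ) (z : ℝ) : Prop :=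
  ∃ q : ι → ℝ, (∀ l ∈ t, FlRound u (a l * b l) (q l)) ∧ FlSum u (t.val.map q) z

/-- `z` is a possible floating-point result of `x + ∑ l ∈ t, a l * b l`.
(As changing a sign is exact, `x - ∑ l ∈ t, a l * b l` is the case of `-a` in place of `a`.) -/
def FlAddDot {ι : Type*} (u x : ℝ) (t : Finset ι) (a b : ι → ℝ) (z : ℝ) : Prop :=
  ∃ q : ι → ℝ, (∀ l ∈ t, FlRound u (a l * b l) (q l)) ∧ FlSum u (x ::ₘ t.val.map q) z

/-- `C` is a possible floating-point result of the matrix product `A * B`. -/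
def FlMul {l m n : Type*} [Fintype m] (u : ℝ) (A : Matrix l m ℝ) (B : Matrix m n ℝ)
    (C : Matrix l n ℝ) : Prop :=
  ∀ i j, FlDot u Finset.univ (fun k => A i k) (fun k => B k j) (C i j)

/-- `D` is a possible floating-point result of `C + A * B`. -/
def FlAddMul {l m n : Type*} [Fintype m] (u : ℝ) (C : Matrix l n ℝ) (A : Matrix l m ℝ)
    (B : Matrix m n ℝ) (D : Matrix l n ℝ) : Prop :=
  ∀ i j, FlAddDot u (C i j) Finset.univ (fun k => A i k) (fun k => B k j) (D i j)

/-- `D` is a possible floating-point result of `C - A * B`. -/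
def FlSubMul {l m n : Type*} [Fintype m] (u : ℝ) (C : Matrix l n ℝ) (A : Matrix l m ℝ)
    (B : Matrix m n ℝ) (D : Matrix l n ℝ) : Prop :=
  FlAddMul u C (-A) B D

/-- `R` is a possible floating-point result of the Cholesky factorization `A = Rᵀ R` with `R` upper
triangular, by the usual algorithm, which reads only the upper triangle of `A`:
`R i j = (A i j - ∑ l < i, R l i * R l j) / R i i` for `i < j` and
`R j j = √(A j j - ∑ l < j, R l j ^ 2)`. -/
def FlChol {s : ℕ} (u : ℝ) (A R : Matrix (Fin s) (Fin s) ℝ) : Prop :=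
  (∀ i j, j < i → R i j = 0) ∧
  (∀ i j, i < j → ∃ t, FlAddDot u (A i j) (Finset.Iio i) (fun l => -R l i) (fun l => R l j) t ∧
    FlDiv u t (R i i) (R i j)) ∧
  (∀ j, ∃ t, FlAddDot u (A j j) (Finset.Iio j) (fun l => -R l j) (fun l => R l j) t ∧
    FlSqrt u t (R j j))

/-- `W` is a possible floating-point result of solving `W * R = V`, i.e. of `V * R⁻¹`, by
substitution, where `R` is upper triangular:
`W i j = (V i j - ∑ l < j, W i l * R l j) / R j j`. -/
def FlSolve {n : Type*} {s : ℕ} (u : ℝ) (V : Matrix n (Fin s) ℝ) (R : Matrix (Fin s) (Fin s) ℝ)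
    (W : Matrix n (Fin s) ℝ) : Prop :=
  ∀ i j, ∃ t, FlAddDot u (V i j) (Finset.Iio j) (fun l => -W i l) (fun l => R l j) t ∧
    FlDiv u t (R j j) (W i j)

/-! ### The algorithm BCGSI+P-1S -/

/-- A floating-point execution of the one-sync reorthogonalized Pythagorean block classical
Gram–Schmidt method BCGSI+P-1S for the block vectors `X 0, …, X (p-1)` with the intra-block
orthogonalization routine `orth` and unit roundoff `u`. All matrices are the computed ones.
`S i k` and `Y i k` are the blocks `S_{i,k}` and `Y_{i,k}`; `Z i k` (for `i + 1 < k`) is the block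
`Q_iᵀ X_k`, and `P k` is `U_{k-1}ᵀ X_k`, both computed one iteration ahead. -/
structure IsRun {m s : ℕ} (u : ℝ)
    (orth : Matrix (Fin m) (Fin s) ℝ → Matrix (Fin m) (Fin s) ℝ × Matrix (Fin s) (Fin s) ℝ)
    (p : ℕ) (X Q U : ℕ → Matrix (Fin m) (Fin s) ℝ)
    (R S Y Z : ℕ → ℕ → Matrix (Fin s) (Fin s) ℝ)
    (T Ω P : ℕ → Matrix (Fin s) (Fin s) ℝ) : Prop where
  /-- `[Q₀, R₀₀] = orth(X₀)` -/
  first : (Q 0, R 0 0) = orth (X 0)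
  /-- `S₀₁ = Q₀ᵀ X₁` -/
  first_S : 1 < p → FlMul u (Q 0).transpose (X 1) (S 0 1)
  /-- `T_k = X_kᵀ X_k` -/
  gram_X : ∀ k, 1 ≤ k → k < p → FlMul u (X k).transpose (X k) (T k)
  /-- `Z_{0:k,k+1} = [Q₀, …, Q_{k-1}]ᵀ X_{k+1}` -/
  sync_Z : ∀ k, 1 ≤ k → k + 1 < p →
    FlMul u (blockRow k Q).transpose (X (k + 1)) (blockCol k fun i => Z i (k + 1))
  /-- `P_{k+1} = U_kᵀ X_{k+1}` -/
  sync_P : ∀ k, 1 ≤ k → k + 1 < p → FlMul u (U k).transpose (X (k + 1)) (P (k + 1))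
  /-- The upper part of the block column `S_{0:k+1,k+1}` is the block column `Z_{0:k,k+1}`. -/
  S_upper : ∀ k, 1 ≤ k → k + 1 < p → ∀ i, i < k → S i (k + 1) = Z i (k + 1)
  /-- Its last block is `Y_{kk}⁻ᵀ (P_{k+1} - Y_{0:k,k}ᵀ Z_{0:k,k+1})`. -/
  S_last : ∀ k, 1 ≤ k → k + 1 < p → ∃ J : Matrix (Fin s) (Fin s) ℝ,
    FlSubMul u (P (k + 1)) (blockCol k fun i => Y i k).transpose
      (blockCol k fun i => Z i (k + 1)) J ∧
    FlSolve u J.transpose (Y k k) (S k (k + 1)).transpose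
  /-- `S_{kk} = chol(T_k - S_{0:k,k}ᵀ S_{0:k,k})` -/
  S_diag : ∀ k, 1 ≤ k → k < p → ∃ H : Matrix (Fin s) (Fin s) ℝ,
    FlSubMul u (T k) (blockCol k fun i => S i k).transpose (blockCol k fun i => S i k) H ∧
    FlChol u H (S k k)
  /-- `U_k = (X_k - [Q₀, …, Q_{k-1}] S_{0:k,k}) S_{kk}⁻¹` -/
  first_proj : ∀ k, 1 ≤ k → k < p → ∃ V : Matrix (Fin m) (Fin s) ℝ,
    FlSubMul u (X k) (blockRow k Q) (blockCol k fun i => S i k) V ∧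
    FlSolve u V (S k k) (U k)
  /-- `Y_{0:k,k} = [Q₀, …, Q_{k-1}]ᵀ U_k` -/
  sync_Y : ∀ k, 1 ≤ k → k < p →
    FlMul u (blockRow k Q).transpose (U k) (blockCol k fun i => Y i k)
  /-- `Ω_k = U_kᵀ U_k` -/
  sync_Ω : ∀ k, 1 ≤ k → k < p → FlMul u (U k).transpose (U k) (Ω k)
  /-- `Y_{kk} = chol(Ω_k - Y_{0:k,k}ᵀ Y_{0:k,k})` -/
  Y_diag : ∀ k, 1 ≤ k → k < p → ∃ H : Matrix (Fin s) (Fin s) ℝ,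
    FlSubMul u (Ω k) (blockCol k fun i => Y i k).transpose (blockCol k fun i => Y i k) H ∧
    FlChol u H (Y k k)
  /-- `Q_k = (U_k - [Q₀, …, Q_{k-1}] Y_{0:k,k}) Y_{kk}⁻¹` -/
  second_proj : ∀ k, 1 ≤ k → k < p → ∃ W : Matrix (Fin m) (Fin s) ℝ,
    FlSubMul u (U k) (blockRow k Q) (blockCol k fun i => Y i k) W ∧
    FlSolve u W (Y k k) (Q k)
  /-- `R_{0:k,k} = S_{0:k,k} + Y_{0:k,k} S_{kk}` -/
  R_upper : ∀ k, 1 ≤ k → k < p →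
    FlAddMul u (blockCol k fun i => S i k) (blockCol k fun i => Y i k) (S k k)
      (blockCol k fun i => R i k)
  /-- `R_{kk} = Y_{kk} S_{kk}` -/
  R_diag : ∀ k, 1 ≤ k → k < p → FlMul u (Y k k) (S k k) (R k k)
  /-- `R` is block upper triangular. -/
  R_lower : ∀ i k, k < i → i < p → R i k = 0

/-- `Q 0, …, Q (p-1)` and `(R i j)_{i, j < p}` are computed by BCGSI+P-1S with unit roundoff `u` from
the block vectors `X 0, …, X (p-1)`, with the intra-block orthogonalization routine `orth`. -/
def Computed {m s : ℕ} (u : ℝ)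
    (orth : Matrix (Fin m) (Fin s) ℝ → Matrix (Fin m) (Fin s) ℝ × Matrix (Fin s) (Fin s) ℝ)
    (p : ℕ) (X Q : ℕ → Matrix (Fin m) (Fin s) ℝ)
    (R : ℕ → ℕ → Matrix (Fin s) (Fin s) ℝ) : Prop :=
  ∃ (U : ℕ → Matrix (Fin m) (Fin s) ℝ) (S Y Z : ℕ → ℕ → Matrix (Fin s) (Fin s) ℝ)
    (T Ω P : ℕ → Matrix (Fin s) (Fin s) ℝ), IsRun u orth p X Q U R S Y Z T Ω P

/-- The result `(Q, R)` of an intra-block orthogonalization of `A` has a small residual, a small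
Cholesky residual and a loss of orthogonality bounded by `c u / (1 - c u κ²(A))`. -/
def IOStable {m s : ℕ} (c u : ℝ) (A Q : Matrix (Fin m) (Fin s) ℝ)
    (R : Matrix (Fin s) (Fin s) ℝ) : Prop :=
  (∃ D : Matrix (Fin s) (Fin s) ℝ,
    R.transpose * R = A.transpose * A + D ∧ ‖D‖ ≤ c * u * ‖A‖ ^ 2) ∧
  (∃ E : Matrix (Fin m) (Fin s) ℝ, A + E = Q * R ∧ ‖E‖ ≤ c * u * ‖A‖) ∧
  ‖1 - Q.transpose * Q‖ ≤ c * u / (1 - c * u * condNum A ^ 2)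

end BlockGS

/-!
BCGSI+P-1S projects every block twice. Both projections have the same form: from `X` with
`‖X‖ ≤ N`, a matrix `Q` with orthonormal columns and `S ≈ Qᵀ X`, they form the Cholesky factor `R`
of `Xᵀ X - Sᵀ S`, which is the Gram matrix of `(I - Q Qᵀ) X`, and `U ≈ (X - Q S) R⁻¹`. If the
singular values of `(I - Q Qᵀ) X` are at least `√a`, then `Rᵀ (I - Uᵀ U) R = O(u N²)` gives
`‖I - Uᵀ U‖ = O(u N² / a)`, and `R` is well enough conditioned for `Qᵀ U` to be of order `u N / √a`
(`projection_bounds`, `fl_projection_bounds`). The a priori unknown `‖U‖` enters the error terms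
only with a factor that is small by assumption, so that it can be absorbed.

For the first projection, `a` is of the order of `σ_min(𝒳)²`. This rests on the residual bound for
the blocks done before: the range of `Q` is nearly that of these blocks, so `(I - Q Qᵀ) X v` is
nearly a value of the full block row at a vector of norm at least `‖v‖` (`quadLB_projection`).
The assumption on `u κ²` now keeps both Cholesky factorizations from breaking down (`FlChol.spec`),
and gives a `U` with singular values close to `1` and `Qᵀ U` small. So the second projection has
`a = 1 / 2` and `N = 2`, and yields orthogonality at the level `O(u)` (`fl_two_projections`).
The residual of a block column involves only quantities of moderate norm (`fl_residual_bound`), and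
the same holds for the delayed coefficients, which solve `R'ᵀ L = Uᵀ X - Yᵀ (Qᵀ X)`, a
well-conditioned system whose exact solution is `Q'ᵀ X` (`fl_delayed_coefficient_bound`).

An induction over the blocks (`Accurate`, `IsRun.accurate_one`, `IsRun.accurate_succ`) carries
orthogonality, residual and coefficients along, with constants that grow by a fixed affine map.
-/

open scoped Matrix

namespace BlockGS

/-! ### Spectral norms -/

/-- The Euclidean norm of a real vector. -/
noncomputable def vecNorm {n : Type*} [Fintype n] (v : n → ℝ) : ℝ :=
  ‖(WithLp.toLp 2 v : EuclideanSpace ℝ n)‖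

section Norms

variable {l m n : Type*} [Fintype l] [Fintype m] [Fintype n]

theorem vecNorm_sq (v : n → ℝ) : vecNorm v ^ 2 = v ⬝ᵥ v := by
  rw [vecNorm, EuclideanSpace.real_norm_sq_eq]
  simp [dotProduct, sq]

theorem vecNorm_nonneg (v : n → ℝ) : 0 ≤ vecNorm v := norm_nonneg _

theorem vecNorm_add_le (v w : n → ℝ) : vecNorm (v + w) ≤ vecNorm v + vecNorm w :=
  norm_add_le (WithLp.toLp 2 v : EuclideanSpace ℝ n) (WithLp.toLp 2 w)

theorem abs_dotProduct_le (v w : n → ℝ) : |v ⬝ᵥ w| ≤ vecNorm v * vecNorm w := by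
  have := abs_real_inner_le_norm (WithLp.toLp 2 w : EuclideanSpace ℝ n) (WithLp.toLp 2 v)
  rw [EuclideanSpace.inner_toLp_toLp] at this
  simpa [vecNorm, mul_comm] using this

theorem vecNorm_mulVec_le [DecidableEq n] (A : Matrix m n ℝ) (v : n → ℝ) :
    vecNorm (A *ᵥ v) ≤ ‖A‖ * vecNorm v :=
  Matrix.l2_opNorm_mulVec A (WithLp.toLp 2 v)

theorem norm_le_of_vecNorm [DecidableEq n] (A : Matrix m n ℝ) {b : ℝ} (hb : 0 ≤ b)
    (h : ∀ v, vecNorm (A *ᵥ v) ≤ b * vecNorm v) : ‖A‖ ≤ b := by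
  rw [Matrix.l2_opNorm_def]
  refine ContinuousLinearMap.opNorm_le_bound _ hb fun x => ?_
  exact h x.ofLp

theorem norm_matrix_mul_le [DecidableEq m] [DecidableEq n] (A : Matrix l m ℝ) (B : Matrix m n ℝ) :
    ‖A * B‖ ≤ ‖A‖ * ‖B‖ := Matrix.l2_opNorm_mul A B

theorem norm_transpose [DecidableEq m] [DecidableEq n] (A : Matrix m n ℝ) : ‖Aᵀ‖ = ‖A‖ := by
  rw [← Matrix.conjTranspose_eq_transpose_of_trivial, Matrix.l2_opNorm_conjTranspose]

theorem norm_transpose_mul_self [DecidableEq n] (A : Matrix m n ℝ) : ‖Aᵀ * A‖ = ‖A‖ ^ 2 := by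
  rw [← Matrix.conjTranspose_eq_transpose_of_trivial, Matrix.l2_opNorm_conjTranspose_mul_self, sq]

theorem norm_one_le [DecidableEq n] : ‖(1 : Matrix n n ℝ)‖ ≤ 1 :=
  norm_le_of_vecNorm _ zero_le_one fun v => by simp

theorem abs_apply_le_norm [DecidableEq n] (A : Matrix m n ℝ) (i : m) (j : n) : |A i j| ≤ ‖A‖ := by
  classical
  have h := vecNorm_mulVec_le A (Pi.single j 1)
  have h1 : vecNorm (Pi.single j 1 : n → ℝ) = 1 := by
    have := vecNorm_sq (Pi.single j 1 : n → ℝ)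
    simp only [dotProduct_single, Pi.single_eq_same, mul_one] at this
    nlinarith [vecNorm_nonneg (Pi.single j 1 : n → ℝ)]
  have h2 := abs_dotProduct_le (Pi.single i 1 : m → ℝ) (A *ᵥ Pi.single j 1)
  have h3 : vecNorm (Pi.single i 1 : m → ℝ) = 1 := by
    have := vecNorm_sq (Pi.single i 1 : m → ℝ)
    simp only [dotProduct_single, Pi.single_eq_same, mul_one] at this
    nlinarith [vecNorm_nonneg (Pi.single i 1 : m → ℝ)]
  rw [single_dotProduct, h3, Matrix.mulVec_single_one, one_mul, one_mul, Matrix.col_apply] at h2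
  rw [h1, mul_one, Matrix.mulVec_single_one] at h
  exact h2.trans h

theorem norm_le_of_abs_apply_le [DecidableEq n] (A : Matrix m n ℝ) {b : ℝ}
    (h : ∀ i j, |A i j| ≤ b) : ‖A‖ ≤ Fintype.card m * Fintype.card n * b := by
  classical
  have hs : ∀ i j (x : ℝ), ‖(Matrix.single i j x : Matrix m n ℝ)‖ ≤ |x| := by
    intro i j x
    refine norm_le_of_vecNorm _ (abs_nonneg _) fun v => ?_
    refine (sq_le_sq₀ (vecNorm_nonneg _) (mul_nonneg (abs_nonneg _) (vecNorm_nonneg _))).1 ?_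
    have h1 : v j * v j ≤ v ⬝ᵥ v :=
      Finset.single_le_sum (f := fun i => v i * v i) (fun i _ => mul_self_nonneg _)
        (Finset.mem_univ j)
    rw [mul_pow, vecNorm_sq, vecNorm_sq, sq_abs, Matrix.single_mulVec]
    simp [dotProduct, Function.update_apply]
    simp [dotProduct] at h1
    nlinarith [sq_nonneg x]
  rw [Matrix.matrix_eq_sum_single A]
  refine (norm_sum_le _ _).trans ?_
  calc _ ≤ ∑ i : m, ∑ j : n, b := by
        refine Finset.sum_le_sum fun i _ => (norm_sum_le _ _).trans ?_
        exact Finset.sum_le_sum fun j _ => (hs i j _).trans (h i j)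
    _ = _ := by simp; ring

end Norms

/-! ### Lower bounds for quadratic forms -/

/-- `a` is a lower bound for the quadratic form of `G` on unit vectors; for `G = Aᵀ A` this says
`a ≤ σ_min(A) ^ 2`. -/
def QuadLB {n : Type*} [Fintype n] (a : ℝ) (G : Matrix n n ℝ) : Prop :=
  ∀ v : n → ℝ, a * (v ⬝ᵥ v) ≤ v ⬝ᵥ G *ᵥ v

section QuadLB

variable {l m n : Type*} [Fintype l] [Fintype m] [Fintype n]

theorem abs_quadForm_le [DecidableEq n] (E : Matrix n n ℝ) (v : n → ℝ) :
    |v ⬝ᵥ E *ᵥ v| ≤ ‖E‖ * (v ⬝ᵥ v) := by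
  rw [← vecNorm_sq]
  nlinarith [abs_dotProduct_le v (E *ᵥ v), vecNorm_mulVec_le E v, vecNorm_nonneg v]

theorem QuadLB.perturb [DecidableEq n] {a e : ℝ} {G H : Matrix n n ℝ} (h : QuadLB a G)
    (hE : ‖H - G‖ ≤ e) :
    QuadLB (a - e) H := by
  intro v
  have h1 := abs_quadForm_le (H - G) v
  have h2 : 0 ≤ v ⬝ᵥ v := by rw [← vecNorm_sq]; positivity
  have h3 := h v
  rw [Matrix.sub_mulVec, dotProduct_sub] at h1
  have h4 := (abs_le.1 h1).1
  nlinarith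

theorem QuadLB.mono {a b : ℝ} {G : Matrix n n ℝ} (h : QuadLB a G) (hb : b ≤ a) : QuadLB b G := by
  intro v
  have h2 : 0 ≤ v ⬝ᵥ v := by rw [← vecNorm_sq]; positivity
  nlinarith [h v]

theorem quadForm_transpose_mul_self (A : Matrix m n ℝ) (v : n → ℝ) :
    v ⬝ᵥ (Aᵀ * A) *ᵥ v = vecNorm (A *ᵥ v) ^ 2 := by
  rw [vecNorm_sq, ← Matrix.mulVec_mulVec, Matrix.dotProduct_mulVec, Matrix.vecMul_transpose]

theorem quadLB_transpose_mul_self {a : ℝ} {A : Matrix m n ℝ} :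
    QuadLB (a ^ 2) (Aᵀ * A) ↔ ∀ v, a ^ 2 * vecNorm v ^ 2 ≤ vecNorm (A *ᵥ v) ^ 2 := by
  simp only [QuadLB, quadForm_transpose_mul_self, vecNorm_sq]

theorem quadLB_transpose_mul_self_of_le {a : ℝ} (ha : 0 ≤ a) {A : Matrix m n ℝ}
    (h : ∀ v, a * vecNorm v ≤ vecNorm (A *ᵥ v)) : QuadLB (a ^ 2) (Aᵀ * A) := by
  refine quadLB_transpose_mul_self.2 fun v => ?_
  rw [← mul_pow]
  exact pow_le_pow_left₀ (mul_nonneg ha (vecNorm_nonneg _)) (h v) 2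

theorem isUnit_of_quadLB [DecidableEq n] {a : ℝ} (ha : 0 < a) {R : Matrix n n ℝ}
    (h : QuadLB a (Rᵀ * R)) : IsUnit R := by
  rw [← Matrix.mulVec_injective_iff_isUnit, ← Matrix.coe_mulVecLin,
    injective_iff_map_eq_zero]
  intro v hv
  have h1 := h v
  rw [quadForm_transpose_mul_self, vecNorm_sq, show R *ᵥ v = 0 from hv, dotProduct_zero] at h1
  have h2 : 0 ≤ v ⬝ᵥ v := by rw [← vecNorm_sq]; positivity
  exact dotProduct_self_eq_zero.1 (by nlinarith)

/-- Multiplication by `R` on the right shrinks spectral norms at most by `σ_min(R)`. -/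
theorem QuadLB.mul_norm_sq_le [DecidableEq n] {a : ℝ} (ha : 0 < a) {R : Matrix n n ℝ}
    (h : QuadLB a (Rᵀ * R)) (B : Matrix m n ℝ) : a * ‖B‖ ^ 2 ≤ ‖B * R‖ ^ 2 := by
  have hu := isUnit_of_quadLB ha h
  have hd := (Matrix.isUnit_iff_isUnit_det R).1 hu
  have hB : B = (B * R) * R⁻¹ := by
    rw [Matrix.mul_assoc, Matrix.mul_nonsing_inv _ hd, Matrix.mul_one]
  have hsq := Real.sq_sqrt ha.le
  have hs : 0 < √a := Real.sqrt_pos.2 ha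
  have hI : ‖R⁻¹‖ ≤ 1 / √a := by
    refine norm_le_of_vecNorm _ (by positivity) fun w => ?_
    rw [div_mul_eq_mul_div, one_mul, le_div_iff₀ hs]
    refine (sq_le_sq₀ (mul_nonneg (vecNorm_nonneg _) hs.le) (vecNorm_nonneg _)).1 ?_
    have h1 := h (R⁻¹ *ᵥ w)
    rw [quadForm_transpose_mul_self, Matrix.mulVec_mulVec, Matrix.mul_nonsing_inv _ hd,
      Matrix.one_mulVec, ← vecNorm_sq] at h1
    rw [mul_pow, hsq]
    linarith
  have h2 : ‖B‖ ≤ ‖B * R‖ * (1 / √a) := by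
    conv_lhs => rw [hB]
    exact (norm_matrix_mul_le _ _).trans (mul_le_mul_of_nonneg_left hI (norm_nonneg _))
  rw [mul_one_div, le_div_iff₀ hs] at h2
  have h3 := pow_le_pow_left₀ (mul_nonneg (norm_nonneg _) hs.le) h2 2
  rw [mul_pow, hsq] at h3
  linarith

/-- A congruence by `R` shrinks spectral norms at most by `σ_min(R) ^ 2`. -/
theorem QuadLB.mul_norm_le [DecidableEq n] {a : ℝ} (ha : 0 < a) {R : Matrix n n ℝ}
    (h : QuadLB a (Rᵀ * R)) (B : Matrix n n ℝ) : a * ‖B‖ ≤ ‖Rᵀ * B * R‖ := by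
  have h1 := h.mul_norm_sq_le ha (Rᵀ * B)
  have h2 := h.mul_norm_sq_le ha Bᵀ
  have h3 : ‖Bᵀ * R‖ = ‖Rᵀ * B‖ := by
    rw [← norm_transpose (Rᵀ * B), Matrix.transpose_mul, Matrix.transpose_transpose]
  rw [h3, norm_transpose] at h2
  refine (sq_le_sq₀ (by positivity) (norm_nonneg _)).1 ?_
  nlinarith

end QuadLB

/-! ### Rounding errors of sums and inner products -/

theorem FlRound.abs_le {u x y : ℝ} (h : FlRound u x y) : |y| ≤ (1 + u) * |x| := by
  have h1 := abs_add_le (y - x) x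
  rw [sub_add_cancel] at h1
  unfold FlRound at h
  linarith

theorem FlSum.one_le_card {u : ℝ} {A : Multiset ℝ} {z : ℝ} (h : FlSum u A z) : 1 ≤ A.card := by
  induction h with
  | single x => simp
  | add _ _ _ h1 h2 => rw [Multiset.card_add]; omega

theorem abs_multiset_sum_le (A : Multiset ℝ) : |A.sum| ≤ (A.map fun x => |x|).sum := by
  induction A using Multiset.induction_on with
  | empty => simp
  | cons a A ih =>
    simp only [Multiset.sum_cons, Multiset.map_cons]
    exact (abs_add_le _ _).trans (by linarith)

/-- Every bracketing of a sum of `n` numbers has at most `n - 1` roundings on each path. -/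
theorem FlSum.error_le {u : ℝ} (hu : 0 ≤ u) {A : Multiset ℝ} {z : ℝ} (h : FlSum u A z) :
    |z - A.sum| ≤ ((1 + u) ^ A.card - 1) * (A.map fun x => |x|).sum := by
  induction h with
  | single x => simp; positivity
  | @add A B x y z hA hB hz ihA ihB =>
    set a := (A.map fun x => |x|).sum with ha
    set b := (B.map fun x => |x|).sum with hb
    have ha0 : 0 ≤ a := (abs_nonneg _).trans (abs_multiset_sum_le A)
    have hb0 : 0 ≤ b := (abs_nonneg _).trans (abs_multiset_sum_le B)
    have hx : |x| ≤ (1 + u) ^ A.card * a := by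
      have := abs_add_le (x - A.sum) A.sum
      rw [sub_add_cancel] at this
      linarith [abs_multiset_sum_le A]
    have hy : |y| ≤ (1 + u) ^ B.card * b := by
      have := abs_add_le (y - B.sum) B.sum
      rw [sub_add_cancel] at this
      linarith [abs_multiset_sum_le B]
    have h1 : (1 : ℝ) ≤ 1 + u := by linarith
    have pA : (1 + u) * (1 + u) ^ A.card ≤ (1 + u) ^ (A + B).card := by
      rw [← pow_succ', Multiset.card_add]
      exact pow_le_pow_right₀ h1 (by have := hB.one_le_card; omega)
    have pB : (1 + u) * (1 + u) ^ B.card ≤ (1 + u) ^ (A + B).card := by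
      rw [← pow_succ', Multiset.card_add]
      exact pow_le_pow_right₀ h1 (by have := hA.one_le_card; omega)
    have hz' : |z - (x + y)| ≤ u * (|x| + |y|) :=
      hz.trans (mul_le_mul_of_nonneg_left (abs_add_le _ _) hu)
    have htri : |z - (A + B).sum| ≤ |z - (x + y)| + |x - A.sum| + |y - B.sum| := by
      rw [Multiset.sum_add, show z - (A.sum + B.sum) = (z - (x + y)) + (x - A.sum) + (y - B.sum) by
        ring]
      exact abs_add_three _ _ _
    rw [Multiset.map_add, Multiset.sum_add (Multiset.map _ A), ← ha, ← hb]
    nlinarith [mul_le_mul_of_nonneg_right pA ha0, mul_le_mul_of_nonneg_right pB hb0,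
      mul_le_mul_of_nonneg_left hx hu, mul_le_mul_of_nonneg_left hy hu]

theorem one_add_pow_sub_one_le {u : ℝ} (hu : 0 ≤ u) (hu1 : u ≤ 1) (n : ℕ) :
    (1 + u) ^ n - 1 ≤ 2 ^ n * u := by
  induction n with
  | zero => simpa using hu
  | succ n ih =>
    have h : (1 + u) ^ n ≤ 2 ^ n := pow_le_pow_left₀ (by linarith) (by linarith) n
    rw [pow_succ, pow_succ]
    nlinarith

/-- The relative error bound for a sum of at most `D + 1` products of floating-point numbers. -/
noncomputable def gam (D : ℕ) (u : ℝ) : ℝ := 2 ^ (D + 2) * u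

theorem gam_nonneg {D : ℕ} {u : ℝ} (hu : 0 ≤ u) : 0 ≤ gam D u := by unfold gam; positivity

theorem le_gam {D : ℕ} {u : ℝ} (hu : 0 ≤ u) : u ≤ gam D u := by
  have : (1 : ℝ) ≤ 2 ^ (D + 2) := one_le_pow₀ (by norm_num)
  unfold gam
  nlinarith

/-- Sum of the rounded products and of an initial value `x`, if there is one: `A` is `{x}` or, for
`x = 0`, empty. -/
theorem sum_rounded_products_error {ι : Type*} {D : ℕ} {u : ℝ} (hu : 0 ≤ u) (hu1 : u ≤ 1)
    {t : Finset ι} (ht : t.card ≤ D) {a b q : ι → ℝ} {A : Multiset ℝ} {x z : ℝ}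
    (hx : A.sum = x) (hx' : (A.map fun x => |x|).sum = |x|) (hA : A.card ≤ 1)
    (hq : ∀ l ∈ t, FlRound u (a l * b l) (q l)) (h : FlSum u (A + t.val.map q) z) :
    |z - (x + ∑ l ∈ t, a l * b l)| ≤ gam D u * (|x| + ∑ l ∈ t, |a l * b l|) := by
  have h1 := h.error_le hu
  simp only [Multiset.sum_add, Multiset.map_add, Multiset.map_map, Multiset.card_add,
    Multiset.card_map, hx, hx', Function.comp_def] at h1
  change |z - (x + ∑ l ∈ t, q l)| ≤ ((1 + u) ^ (A.card + t.card) - 1) *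
    (|x| + ∑ l ∈ t, |q l|) at h1
  have h2 : ∑ l ∈ t, |q l| ≤ (1 + u) * ∑ l ∈ t, |a l * b l| := by
    rw [Finset.mul_sum]
    exact Finset.sum_le_sum fun l hl => (hq l hl).abs_le
  have h3 : |∑ l ∈ t, q l - ∑ l ∈ t, a l * b l| ≤ u * ∑ l ∈ t, |a l * b l| := by
    rw [← Finset.sum_sub_distrib, Finset.mul_sum]
    exact (Finset.abs_sum_le_sum_abs _ _).trans (Finset.sum_le_sum fun l hl => hq l hl)
  have h4 : |z - (x + ∑ l ∈ t, a l * b l)| ≤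
      |z - (x + ∑ l ∈ t, q l)| + |∑ l ∈ t, q l - ∑ l ∈ t, a l * b l| := by
    refine le_trans (le_of_eq ?_) (abs_add_le _ _)
    congr 1; ring
  have h5 : (1 + u) * (1 + u) ^ (A.card + t.card) ≤ (1 + u) ^ (D + 2) := by
    rw [← pow_succ']
    exact pow_le_pow_right₀ (by linarith) (by omega)
  have h6 : 1 ≤ (1 + u) ^ (A.card + t.card) := one_le_pow₀ (by linarith)
  have h7 := one_add_pow_sub_one_le hu hu1 (D + 2)
  have h8 : 0 ≤ ∑ l ∈ t, |a l * b l| := Finset.sum_nonneg fun _ _ => abs_nonneg _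
  unfold gam
  set P := (1 + u) ^ (A.card + t.card)
  set σ := ∑ l ∈ t, |a l * b l|
  calc _ ≤ (P - 1) * (|x| + (1 + u) * σ) + u * σ := by
        have := mul_le_mul_of_nonneg_left h2 (sub_nonneg.2 h6)
        nlinarith
    _ ≤ ((1 + u) * P - 1) * (|x| + σ) := by
        nlinarith [mul_nonneg hu (abs_nonneg x), mul_nonneg (mul_nonneg hu (abs_nonneg x))
          (zero_le_one.trans h6)]
    _ ≤ _ := mul_le_mul_of_nonneg_right (by linarith) (by positivity)

theorem FlDot.error_le {ι : Type*} {D : ℕ} {u : ℝ} (hu : 0 ≤ u) (hu1 : u ≤ 1)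
    {t : Finset ι} (ht : t.card ≤ D) {a b : ι → ℝ} {z : ℝ} (h : FlDot u t a b z) :
    |z - ∑ l ∈ t, a l * b l| ≤ gam D u * ∑ l ∈ t, |a l * b l| := by
  obtain ⟨q, hq, hz⟩ := h
  simpa using sum_rounded_products_error (A := 0) (x := 0) hu hu1 ht (by simp) (by simp) (by simp)
    hq (by simpa using hz)

theorem FlAddDot.error_le {ι : Type*} {D : ℕ} {u : ℝ} (hu : 0 ≤ u) (hu1 : u ≤ 1)
    {t : Finset ι} (ht : t.card ≤ D) {a b : ι → ℝ} {x z : ℝ} (h : FlAddDot u x t a b z) :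
    |z - (x + ∑ l ∈ t, a l * b l)| ≤ gam D u * (|x| + ∑ l ∈ t, |a l * b l|) := by
  obtain ⟨q, hq, hz⟩ := h
  exact sum_rounded_products_error (A := {x}) hu hu1 ht (by simp) (by simp) (by simp)
    hq (by simpa using hz)

/-- Backward error of one step of a substitution. -/
theorem FlAddDot.div_error_le {ι : Type*} {D : ℕ} {u : ℝ} (hu : 0 ≤ u) (hu1 : u ≤ 1)
    {t : Finset ι} (ht : t.card ≤ D) {a b : ι → ℝ} {x τ r z : ℝ} (h : FlAddDot u x t a b τ)
    (hr : r ≠ 0) (hz : FlDiv u τ r z) :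
    |z * r - (x + ∑ l ∈ t, a l * b l)| ≤ 3 * gam D u * (|x| + ∑ l ∈ t, |a l * b l|) := by
  have h1 := h.error_le hu hu1 ht
  have h2 : |z * r - τ| ≤ u * |τ| := by
    have h3 := mul_le_mul_of_nonneg_right (hz hr) (abs_nonneg r)
    rw [mul_assoc, ← abs_mul, ← abs_mul, sub_mul, div_mul_cancel₀ _ hr] at h3
    exact h3
  have h4 := abs_add_le (z * r - τ) (τ - (x + ∑ l ∈ t, a l * b l))
  have h5 := abs_add_le (τ - (x + ∑ l ∈ t, a l * b l)) (x + ∑ l ∈ t, a l * b l)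
  have h6 := abs_add_le x (∑ l ∈ t, a l * b l)
  have h7 := Finset.abs_sum_le_sum_abs (fun l => a l * b l) t
  rw [sub_add_sub_cancel] at h4
  rw [sub_add_cancel] at h5
  have hg := gam_nonneg (D := D) hu
  have hg' := le_gam (D := D) hu
  set σ := ∑ l ∈ t, |a l * b l|
  have h8 : 0 ≤ σ := Finset.sum_nonneg fun _ _ => abs_nonneg _
  have h9 : |τ| ≤ (1 + gam D u) * (|x| + σ) := by linarith
  have h10 : 0 ≤ |x| + σ := by positivity
  have h11 : u * |τ| ≤ 2 * gam D u * (|x| + σ) := by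
    calc u * |τ| ≤ u * ((1 + gam D u) * (|x| + σ)) := mul_le_mul_of_nonneg_left h9 hu
      _ = (u + u * gam D u) * (|x| + σ) := by ring
      _ ≤ _ := mul_le_mul_of_nonneg_right (by nlinarith) h10
  linarith

/-! ### Rounding errors of matrix operations -/

/-- The constant in the normwise error bounds for matrices with at most `D` rows and columns. -/
noncomputable def matConst (D : ℕ) : ℝ := 3 * 2 ^ (D + 2) * (D ^ 2 * (D + 1))

theorem matConst_nonneg (D : ℕ) : 0 ≤ matConst D := by unfold matConst; positivity

section MatrixErrors

variable {l m n : Type*} [Fintype l] [Fintype m] [Fintype n]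
  {D : ℕ} {u : ℝ}

/-- An entrywise error bound yields a normwise error bound. -/
theorem norm_le_of_entry_error [DecidableEq n] (hl : Fintype.card l ≤ D) (hn : Fintype.card n ≤ D)
    (hu : 0 ≤ u) {E : Matrix l n ℝ} {b c : ℝ} (hb : 0 ≤ b) (hc : 0 ≤ c)
    (h : ∀ i j, |E i j| ≤ 3 * gam D u * (b + D * c)) : ‖E‖ ≤ matConst D * u * (b + c) := by
  have hg := gam_nonneg (D := D) hu
  refine (norm_le_of_abs_apply_le E h).trans ?_
  have h1 : (Fintype.card l * Fintype.card n : ℝ) ≤ D ^ 2 := by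
    rw [sq]; gcongr
  calc _ ≤ (D : ℝ) ^ 2 * (3 * gam D u * (b + D * c)) :=
        mul_le_mul_of_nonneg_right h1 (by positivity)
    _ ≤ (D : ℝ) ^ 2 * (3 * gam D u * ((D + 1) * (b + c))) := by
        gcongr
        have : 0 ≤ D * b := by positivity
        linarith
    _ = _ := by unfold matConst gam; ring

theorem sum_abs_mul_le [DecidableEq m] [DecidableEq n] (hm : Fintype.card m ≤ D)
    (A : Matrix l m ℝ) (B : Matrix m n ℝ) (t : Finset m) (i : l) (j : n) :
    ∑ k ∈ t, |A i k * B k j| ≤ D * (‖A‖ * ‖B‖) := by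
  calc _ ≤ ∑ k ∈ t, ‖A‖ * ‖B‖ := Finset.sum_le_sum fun k _ => by
        rw [abs_mul]
        exact mul_le_mul (abs_apply_le_norm A i k) (abs_apply_le_norm B k j) (abs_nonneg _)
          (norm_nonneg _)
    _ = t.card * (‖A‖ * ‖B‖) := by simp
    _ ≤ _ := by
        gcongr
        exact t.card_le_univ.trans hm

theorem FlMul.error_le [DecidableEq m] [DecidableEq n] (hl : Fintype.card l ≤ D)
    (hm : Fintype.card m ≤ D) (hn : Fintype.card n ≤ D) (hu : 0 ≤ u) (hu1 : u ≤ 1)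
    {A : Matrix l m ℝ} {B : Matrix m n ℝ} {C : Matrix l n ℝ} (h : FlMul u A B C) :
    ‖C - A * B‖ ≤ matConst D * u * (‖A‖ * ‖B‖) := by
  rw [← zero_add (‖A‖ * ‖B‖)]
  refine norm_le_of_entry_error hl hn hu le_rfl (by positivity) fun i j => ?_
  have h1 := (h i j).error_le hu hu1 hm
  rw [Matrix.sub_apply, Matrix.mul_apply]
  have hg := gam_nonneg (D := D) hu
  have h2 := mul_le_mul_of_nonneg_left (sum_abs_mul_le hm A B Finset.univ i j) hg
  have h3 : 0 ≤ gam D u * (D * (‖A‖ * ‖B‖)) := by positivity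
  linarith

theorem FlAddMul.error_le [DecidableEq m] [DecidableEq n] (hl : Fintype.card l ≤ D)
    (hm : Fintype.card m ≤ D) (hn : Fintype.card n ≤ D) (hu : 0 ≤ u) (hu1 : u ≤ 1)
    {A : Matrix l m ℝ} {B : Matrix m n ℝ} {C E : Matrix l n ℝ} (h : FlAddMul u C A B E) :
    ‖E - (C + A * B)‖ ≤ matConst D * u * (‖C‖ + ‖A‖ * ‖B‖) := by
  refine norm_le_of_entry_error hl hn hu (norm_nonneg _) (by positivity) fun i j => ?_
  have h1 := (h i j).error_le hu hu1 hm
  rw [Matrix.sub_apply, Matrix.add_apply, Matrix.mul_apply]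
  have hg := gam_nonneg (D := D) hu
  have h2 := mul_le_mul_of_nonneg_left (sum_abs_mul_le hm A B Finset.univ i j) hg
  have h3 : 0 ≤ gam D u * (‖C‖ + D * (‖A‖ * ‖B‖)) := by positivity
  have h4 := mul_le_mul_of_nonneg_left (abs_apply_le_norm C i j) hg
  linarith

theorem FlSubMul.error_le [DecidableEq m] [DecidableEq n] (hl : Fintype.card l ≤ D)
    (hm : Fintype.card m ≤ D) (hn : Fintype.card n ≤ D) (hu : 0 ≤ u) (hu1 : u ≤ 1)
    {A : Matrix l m ℝ} {B : Matrix m n ℝ} {C E : Matrix l n ℝ} (h : FlSubMul u C A B E) :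
    ‖E - (C - A * B)‖ ≤ matConst D * u * (‖C‖ + ‖A‖ * ‖B‖) := by
  have h1 := FlAddMul.error_le hl hm hn hu hu1 h
  rwa [Matrix.neg_mul, ← sub_eq_add_neg, norm_neg] at h1

/-- Backward error of a substitution. No condition number of `R` enters, since the solution `W`
occurs in the bound. -/
theorem FlSolve.error_le {s : ℕ} (hl : Fintype.card l ≤ D) (hs : s ≤ D) (hu : 0 ≤ u) (hu1 : u ≤ 1)
    {V W : Matrix l (Fin s) ℝ} {R : Matrix (Fin s) (Fin s) ℝ} (hR : ∀ i j, j < i → R i j = 0)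
    (hd : ∀ i, R i i ≠ 0) (h : FlSolve u V R W) :
    ‖W * R - V‖ ≤ matConst D * u * (‖V‖ + ‖W‖ * ‖R‖) := by
  have hs' : Fintype.card (Fin s) ≤ D := by simpa using hs
  refine norm_le_of_entry_error hl hs' hu (norm_nonneg _) (by positivity) fun i j => ?_
  obtain ⟨t, ht, hz⟩ := h i j
  have h1 := ht.div_error_le hu hu1 ((Finset.card_le_univ _).trans hs') (hd j) hz
  have h2 : (W * R) i j = W i j * R j j + ∑ l ∈ Finset.Iio j, W i l * R l j := by
    rw [Matrix.mul_apply, ← Finset.sum_subset (Finset.subset_univ (insert j (Finset.Iio j))),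
      Finset.sum_insert (by simp)]
    intro k _ hk
    simp only [Finset.mem_insert, Finset.mem_Iio, not_or, not_lt] at hk
    rw [hR k j (lt_of_le_of_ne hk.2 (Ne.symm hk.1)), mul_zero]
  have hg := gam_nonneg (D := D) hu
  have h3 := sum_abs_mul_le hs' W R (Finset.Iio j) i j
  simp only [neg_mul, abs_neg, Finset.sum_neg_distrib] at h1
  rw [Matrix.sub_apply, h2]
  have h4 := abs_apply_le_norm V i j
  calc _ = |W i j * R j j - (V i j + -∑ l ∈ Finset.Iio j, W i l * R l j)| := by congr 1; ring
    _ ≤ _ := h1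
    _ ≤ _ := by gcongr

end MatrixErrors

/-! ### The Cholesky factorization in floating-point arithmetic -/

section Cholesky

variable {s : ℕ}

/-- A triangular system with the leading `j × j` block of `R`, padded with zeros. -/
theorem exists_leading_solve {R : Matrix (Fin s) (Fin s) ℝ} (hR : ∀ i j, j < i → R i j = 0)
    {j : Fin s} (hd : ∀ i < j, R i i ≠ 0) {r : Fin s → ℝ} (hr : ∀ i, j ≤ i → r i = 0) :
    ∃ y : Fin s → ℝ, (∀ i, j ≤ i → y i = 0) ∧ R *ᵥ y = r := by
  -- The columns of `R` from `j` on are replaced by unit vectors.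
  set M : Matrix (Fin s) (Fin s) ℝ :=
    Matrix.of fun l i => if i < j then R l i else if l = i then 1 else 0 with hM
  have hMd : IsUnit M.det := by
    rw [Matrix.det_of_isUpperTriangular, isUnit_iff_ne_zero, Finset.prod_ne_zero_iff]
    · intro i _
      by_cases hi : i < j
      · simpa [hM, hi] using hd i hi
      · simp [hM, hi]
    · intro l i hli
      have hli' : i < l := hli
      by_cases hi : i < j
      · simpa [hM, hi] using hR l i hli'
      · simp [hM, hi, hli'.ne']
  refine ⟨M⁻¹ *ᵥ r, ?_⟩
  have hMy : M *ᵥ (M⁻¹ *ᵥ r) = r := by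
    rw [Matrix.mulVec_mulVec, Matrix.mul_nonsing_inv _ hMd, Matrix.one_mulVec]
  set y := M⁻¹ *ᵥ r
  have hy : ∀ i, j ≤ i → y i = 0 := by
    intro l hl
    rw [← hr l hl, ← hMy, Matrix.mulVec, dotProduct, Finset.sum_eq_single l]
    · simp [hM, hl.not_gt]
    · intro i _ hi
      by_cases hij : i < j
      · simp [hM, hij, hR l i (hij.trans_le hl)]
      · simp [hM, hij, hi.symm]
    · simp
  refine ⟨hy, ?_⟩
  rw [← hMy]
  ext l
  simp only [Matrix.mulVec, dotProduct]
  refine Finset.sum_congr rfl fun i _ => ?_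
  by_cases hij : i < j
  · simp [hM, hij]
  · simp [hy i (not_lt.1 hij)]

theorem transpose_mul_self_apply_of_upperTriangular {R : Matrix (Fin s) (Fin s) ℝ}
    (hR : ∀ i j, j < i → R i j = 0) (i j : Fin s) :
    (Rᵀ * R) i j = R i i * R i j + ∑ l ∈ Finset.Iio i, R l i * R l j := by
  simp only [Matrix.mul_apply, Matrix.transpose_apply]
  rw [← Finset.sum_subset (Finset.subset_univ (insert i (Finset.Iio i))),
    Finset.sum_insert (by simp)]
  intro k _ hk
  simp only [Finset.mem_insert, Finset.mem_Iio, not_or, not_lt] at hk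
  rw [hR k i (lt_of_le_of_ne hk.2 (Ne.symm hk.1)), zero_mul]

/-- The Schur complement of a positive definite matrix `G` is bounded below: if the leading columns
of `R` form an approximate Cholesky factor of `G`, the exact pivot `G j j - ∑ l < j, R l j ^ 2` is
positive. The entries of column `j` enter the errors `e + γ * ∑ l < i, |R l i * R l j|`, as their
size is only known once the pivot is. -/
theorem pivot_lower_bound {G R : Matrix (Fin s) (Fin s) ℝ} {lam g γ e η : ℝ} (hG : Gᵀ = G)
    (hQ : QuadLB lam G) (hR : ∀ i j, j < i → R i j = 0) {j : Fin s} (hd : ∀ i < j, R i i ≠ 0)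
    (hγ : 0 ≤ γ) (hc : ∀ i < j, (Rᵀ * R) i i ≤ g)
    (he : ∀ i < j, |(Rᵀ * R - G) i j| ≤ e + γ * ∑ l ∈ Finset.Iio i, |R l i * R l j|)
    (hη : ∀ i < j, ∀ k < j, |(Rᵀ * R - G) i k| ≤ η) (he0 : 0 ≤ e) (hη0 : 0 ≤ η) (hg : 0 ≤ g)
    (hs : s * (2 * e + γ * g + η) ≤ lam / 4) :
    3 / 4 * lam ≤
      G j j - ∑ l ∈ Finset.Iio j, R l j ^ 2 + s * γ * ∑ l ∈ Finset.Iio j, R l j ^ 2 := by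
  set ρ := ∑ l ∈ Finset.Iio j, R l j ^ 2 with hρ
  obtain ⟨y, hy, hRy⟩ := exists_leading_solve hR hd
    (r := fun l => if l < j then R l j else 0) (fun i hi => by simp [hi.not_gt])
  set E := Rᵀ * R - G with hE
  have hρ0 : 0 ≤ ρ := Finset.sum_nonneg fun _ _ => sq_nonneg _
  set Y := y ⬝ᵥ y with hY
  have hY0 : 0 ≤ Y := by rw [hY, ← vecNorm_sq]; positivity
  have hyy : y ⬝ᵥ (Rᵀ * R) *ᵥ y = ρ := by
    rw [quadForm_transpose_mul_self, vecNorm_sq, hRy, hρ, dotProduct,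
      ← Finset.sum_subset (Finset.subset_univ (Finset.Iio j))]
    · refine Finset.sum_congr rfl fun l hl => ?_
      simp [Finset.mem_Iio.1 hl, sq]
    · intro l _ hl
      simp [Finset.mem_Iio.not.1 hl]
  have hyj : y ⬝ᵥ (Rᵀ * R) *ᵥ Pi.single j 1 = ρ := by
    rw [← Matrix.mulVec_mulVec, Matrix.dotProduct_mulVec, Matrix.vecMul_transpose, hRy, hρ,
      dotProduct, ← Finset.sum_subset (Finset.subset_univ (Finset.Iio j))]
    · refine Finset.sum_congr rfl fun l hl => ?_
      simp [Finset.mem_Iio.1 hl, sq]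
    · intro l _ hl
      simp [Finset.mem_Iio.not.1 hl]
  -- Test vector for the Schur complement: `R` maps `e_j - y` to zero in the coordinates `l < j`.
  have hw := hQ (Pi.single j 1 - y)
  have hww : (Pi.single j 1 - y) ⬝ᵥ (Pi.single j 1 - y) = 1 + Y := by
    simp [sub_dotProduct, dotProduct_sub, hy j le_rfl, hY]
  have hwG : (Pi.single j 1 - y) ⬝ᵥ G *ᵥ (Pi.single j 1 - y) =
      G j j - ρ + 2 * (y ⬝ᵥ E *ᵥ Pi.single j 1) - y ⬝ᵥ E *ᵥ y := by
    have h1 : (Pi.single j 1) ⬝ᵥ G *ᵥ y = y ⬝ᵥ G *ᵥ Pi.single j 1 := by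
      rw [Matrix.dotProduct_mulVec, ← Matrix.mulVec_transpose, hG, dotProduct_comm]
    have h2 : (Pi.single j 1) ⬝ᵥ G *ᵥ Pi.single j 1 = G j j := by
      simp
    rw [hE, Matrix.sub_mulVec, Matrix.sub_mulVec, dotProduct_sub, dotProduct_sub, hyy, hyj,
      Matrix.mulVec_sub, sub_dotProduct, dotProduct_sub, dotProduct_sub, h1, h2]
    ring
  have hsum : ∑ _i : Fin s, (1 : ℝ) = s := by simp
  have hYs : Y = ∑ i, y i ^ 2 := by simp [hY, dotProduct, sq]
  have hb1 : 2 * (y ⬝ᵥ E *ᵥ Pi.single j 1) ≤ s * e + e * Y + γ * g * Y + s * γ * ρ := by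
    have h1 : ∀ i, 2 * (y i * E i j) ≤ e + e * y i ^ 2 + γ * g * y i ^ 2 + γ * ρ := by
      intro i
      by_cases hi : i < j
      · have h2 : 2 * (y i * E i j) ≤ 2 * (|y i| * |E i j|) := by
          rw [← abs_mul]; linarith [le_abs_self (y i * E i j)]
        have h3 := mul_le_mul_of_nonneg_left (he i hi) (abs_nonneg (y i))
        have h4 : 2 * (|y i| * ∑ l ∈ Finset.Iio i, |R l i * R l j|) ≤ g * y i ^ 2 + ρ := by
          have h5 : ∑ l ∈ Finset.Iio i, R l i ^ 2 ≤ g := by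
            have h6 := hc i hi
            rw [transpose_mul_self_apply_of_upperTriangular hR] at h6
            simp only [← sq] at h6
            linarith [sq_nonneg (R i i)]
          have h7 : ∑ l ∈ Finset.Iio i, R l j ^ 2 ≤ ρ :=
            Finset.sum_le_sum_of_subset_of_nonneg (Finset.Iio_subset_Iio hi.le)
              fun _ _ _ => sq_nonneg _
          have h8 : 2 * (|y i| * ∑ l ∈ Finset.Iio i, |R l i * R l j|) ≤
              ∑ l ∈ Finset.Iio i, (R l i ^ 2 * y i ^ 2 + R l j ^ 2) := by
            rw [Finset.mul_sum, Finset.mul_sum]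
            refine Finset.sum_le_sum fun l _ => ?_
            rw [abs_mul, ← sq_abs (R l i), ← sq_abs (y i), ← sq_abs (R l j)]
            nlinarith [sq_nonneg (|R l i| * |y i| - |R l j|)]
          rw [Finset.sum_add_distrib, ← Finset.sum_mul] at h8
          nlinarith [mul_le_mul_of_nonneg_right h5 (sq_nonneg (y i))]
        have h9 : 2 * |y i| ≤ 1 + y i ^ 2 := by
          rw [← sq_abs (y i)]; nlinarith [sq_nonneg (|y i| - 1)]
        nlinarith [mul_le_mul_of_nonneg_left h9 he0, mul_le_mul_of_nonneg_left h4 hγ]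
      · rw [hy i (not_lt.1 hi)]
        have : 0 ≤ γ * ρ := mul_nonneg hγ hρ0
        simp
        linarith
    have h2 := Finset.sum_le_sum fun i (_ : i ∈ Finset.univ) => h1 i
    simp only [Finset.sum_add_distrib, ← Finset.mul_sum, ← hYs, Finset.sum_const,
      Finset.card_univ, Fintype.card_fin, nsmul_eq_mul] at h2
    have h3 : ∑ i, y i * E i j = y ⬝ᵥ E *ᵥ Pi.single j 1 := by
      simp [dotProduct]
    rw [h3] at h2
    linarith
  have hb2 : -(y ⬝ᵥ E *ᵥ y) ≤ s * η * Y := by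
    have h1 : ∀ i k, -(y i * (E i k * y k)) ≤ η / 2 * (y i ^ 2 + y k ^ 2) := by
      intro i k
      by_cases hi : i < j
      · by_cases hk : k < j
        · have h2 : -(y i * (E i k * y k)) ≤ |E i k| * (|y i| * |y k|) := by
            rw [← abs_mul, ← abs_mul]
            refine le_trans (le_of_eq ?_) (neg_le_abs _)
            ring
          have h3 := mul_le_mul_of_nonneg_right (hη i hi k hk)
            (mul_nonneg (abs_nonneg (y i)) (abs_nonneg (y k)))
          rw [← sq_abs (y i), ← sq_abs (y k)]
          nlinarith [mul_nonneg hη0 (sq_nonneg (|y i| - |y k|))]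
        · rw [hy k (not_lt.1 hk)]
          simp
          positivity
      · rw [hy i (not_lt.1 hi)]
        simp
        positivity
    have h2 := Finset.sum_le_sum fun i (_ : i ∈ Finset.univ) =>
      Finset.sum_le_sum fun k (_ : k ∈ Finset.univ) => h1 i k
    simp only [Finset.sum_add_distrib, ← Finset.mul_sum, ← hYs, Finset.sum_const,
      Finset.card_univ, Fintype.card_fin, nsmul_eq_mul, Finset.sum_neg_distrib] at h2
    have h3 : ∑ i, y i * ∑ k, E i k * y k = y ⬝ᵥ E *ᵥ y := rfl
    rw [h3] at h2
    linarith
  rw [hww, hwG] at hw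
  have hs1 : (1 : ℝ) ≤ s := by
    have := j.pos
    exact_mod_cast this
  have hsg : 0 ≤ γ * g := mul_nonneg hγ hg
  have h1 : s * e + e * Y + γ * g * Y + s * η * Y ≤ lam / 4 * (1 + Y) := by
    calc _ ≤ s * (2 * e + γ * g + η) * (1 + Y) := by
          have : 0 ≤ e * Y := by positivity
          have : 0 ≤ γ * g * Y := by positivity
          have : 0 ≤ (s - 1) * (e * Y) := mul_nonneg (by linarith) (by positivity)
          have : 0 ≤ (s - 1) * (γ * g * Y) := mul_nonneg (by linarith) (by positivity)
          have : 0 ≤ s * e := by positivity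
          have : 0 ≤ s * (γ * g) := by positivity
          have : 0 ≤ s * η := by positivity
          nlinarith
      _ ≤ _ := mul_le_mul_of_nonneg_right hs (by positivity)
  have hl : 0 ≤ lam := by
    have : 0 ≤ s * (2 * e + γ * g + η) := by positivity
    linarith
  nlinarith [mul_nonneg hl hY0]

theorem FlSqrt.sq_error_le {u t r : ℝ} (hu : 0 ≤ u) (hu1 : u < 1) (ht : 0 < t)
    (h : FlSqrt u t r) : 0 < r ∧ |r ^ 2 - t| ≤ 3 * u * t := by
  have h' := abs_le.1 ((h ht.le).trans_eq (by rw [abs_of_nonneg (Real.sqrt_nonneg t)]))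
  have hsq := Real.sq_sqrt ht.le
  have hq := Real.sqrt_pos.2 ht
  set q := √t
  have hr : 0 < r := by nlinarith
  have hut := mul_nonneg hu ht.le
  refine ⟨hr, abs_le.2 ⟨?_, ?_⟩⟩
  · have h1 : (1 - u) * q ≤ r := by linarith [h'.1]
    have h2 := pow_le_pow_left₀ (mul_nonneg (by linarith) hq.le) h1 2
    rw [mul_pow, hsq] at h2
    nlinarith [mul_nonneg hut hu]
  · have h1 : r ≤ (1 + u) * q := by linarith [h'.2]
    have h2 := pow_le_pow_left₀ hr.le h1 2
    rw [mul_pow, hsq] at h2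
    nlinarith [mul_nonneg hut (sub_nonneg.2 hu1.le)]

/-- Floating-point Cholesky factorization of a perturbation `H` of a symmetric matrix `G` that is
sufficiently positive definite: no breakdown occurs, and the factor is backward stable. Here `e`
bounds the perturbation. -/
theorem FlChol.spec {D : ℕ} (hsD : s ≤ D) {u : ℝ} (hu : 0 ≤ u) (hu1 : u ≤ 1)
    {G H R : Matrix (Fin s) (Fin s) ℝ} {lam g e : ℝ} (hG : Gᵀ = G) (hg : ‖G‖ ≤ g)
    (he : ‖H - G‖ ≤ e) (hlam : 0 < lam) (hQ : QuadLB lam G)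
    (hsmall : 400 * s * (e + gam D u * g) ≤ lam) (h : FlChol u H R) :
    (∀ i, R i i ≠ 0) ∧ ‖Rᵀ * R - G‖ ≤ s ^ 2 * (40 * (e + gam D u * g)) := by
  obtain ⟨hR, hoff, hdiag⟩ := h
  set γ := gam D u with hγd
  have hγ : 0 ≤ γ := gam_nonneg hu
  have huγ : u ≤ γ := le_gam hu
  have hg0 : 0 ≤ g := (norm_nonneg _).trans hg
  have he0 : 0 ≤ e := (norm_nonneg _).trans he
  have hHe : ∀ i j, |H i j - G i j| ≤ e := fun i j => (abs_apply_le_norm (H - G) i j).trans he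
  have hGg : ∀ i j, |G i j| ≤ g := fun i j => (abs_apply_le_norm G i j).trans hg
  have hcard : ∀ i : Fin s, (Finset.Iio i).card ≤ D := fun i =>
    (Finset.card_le_univ _).trans (by simpa using hsD)
  have hlg : ∀ j : Fin s, lam ≤ G j j := by
    intro j
    have := hQ (Pi.single j 1)
    simpa using this
  rcases Nat.eq_zero_or_pos s with rfl | hs
  · refine ⟨fun i => i.elim0, ?_⟩
    rw [show Rᵀ * R - G = 0 by ext i; exact i.elim0, norm_zero]
    positivity
  have hs1 : (1 : ℝ) ≤ s := by exact_mod_cast hs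
  have hlamg : lam ≤ g := (hlg ⟨0, hs⟩).trans ((le_abs_self _).trans (hGg _ _))
  have hγg : 0 ≤ γ * g := by positivity
  have hsγ : 400 * s * γ ≤ 1 := by
    have h1 : 400 * s * γ * g ≤ 1 * g := by
      have : 0 ≤ s * e := by positivity
      nlinarith
    exact le_of_mul_le_mul_right h1 (hlam.trans_le hlamg)
  have hγ1 : 400 * γ ≤ 1 := by nlinarith
  have hsm : 400 * (e + γ * g) ≤ lam := by nlinarith
  have hH : ∀ i j, |H i j| ≤ 2 * g := by
    intro i j
    have h1 := abs_add_le (H i j - G i j) (G i j)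
    rw [sub_add_cancel] at h1
    linarith [hHe i j, hGg i j]
  -- errors above the diagonal
  have hO : ∀ i j, i < j → R i i ≠ 0 → |(Rᵀ * R - G) i j| ≤
      (e + 6 * (γ * g)) + 3 * γ * ∑ l ∈ Finset.Iio i, |R l i * R l j| := by
    intro i j hij hne
    obtain ⟨t, ht, hz⟩ := hoff i j hij
    have h1 := ht.div_error_le hu hu1 (hcard i) hne hz
    simp only [neg_mul, abs_neg, Finset.sum_neg_distrib] at h1
    rw [Matrix.sub_apply, transpose_mul_self_apply_of_upperTriangular hR]
    have h2 := abs_add_le (R i j * R i i - (H i j + -∑ l ∈ Finset.Iio i, R l i * R l j))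
      (H i j - G i j)
    have h3 : R i j * R i i - (H i j + -∑ l ∈ Finset.Iio i, R l i * R l j) + (H i j - G i j) =
      R i i * R i j + ∑ l ∈ Finset.Iio i, R l i * R l j - G i j := by ring
    rw [h3] at h2
    have h4 := mul_le_mul_of_nonneg_left (hH i j) (mul_nonneg (by norm_num : (0 : ℝ) ≤ 3) hγ)
    linarith [hHe i j]
  have hE : ∀ i k, i < k → R i i ≠ 0 → (Rᵀ * R) i i ≤ 3 * g → (Rᵀ * R) k k ≤ 3 * g →
      |(Rᵀ * R - G) i k| ≤ 40 * (e + γ * g) := by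
    intro i k hik hne hi hk
    refine (hO i k hik hne).trans ?_
    have h1 : ∑ l ∈ Finset.Iio i, |R l i * R l k| ≤ 3 * g := by
      have h2 : ∑ l ∈ Finset.Iio i, R l i ^ 2 ≤ 3 * g := by
        have h6 := hi
        rw [transpose_mul_self_apply_of_upperTriangular hR] at h6
        simp only [← sq] at h6
        linarith [sq_nonneg (R i i)]
      have h3 : ∑ l ∈ Finset.Iio i, R l k ^ 2 ≤ 3 * g := by
        have h6 := hk
        rw [transpose_mul_self_apply_of_upperTriangular hR] at h6
        simp only [← sq] at h6
        have : ∑ l ∈ Finset.Iio i, R l k ^ 2 ≤ ∑ l ∈ Finset.Iio k, R l k ^ 2 :=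
          Finset.sum_le_sum_of_subset_of_nonneg (Finset.Iio_subset_Iio hik.le)
            fun _ _ _ => sq_nonneg _
        linarith [sq_nonneg (R k k)]
      have h4 : ∑ l ∈ Finset.Iio i, |R l i * R l k| ≤
          ∑ l ∈ Finset.Iio i, (R l i ^ 2 + R l k ^ 2) / 2 := by
        refine Finset.sum_le_sum fun l _ => ?_
        rw [abs_mul, ← sq_abs (R l i), ← sq_abs (R l k)]
        nlinarith [sq_nonneg (|R l i| - |R l k|)]
      rw [← Finset.sum_div, Finset.sum_add_distrib] at h4
      linarith
    have h5 := mul_le_mul_of_nonneg_left h1 (mul_nonneg (by norm_num : (0 : ℝ) ≤ 3) hγ)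
    linarith
  have hsymm : ∀ i k, (Rᵀ * R - G) i k = (Rᵀ * R - G) k i := by
    intro i k
    have : (Rᵀ * R - G)ᵀ = Rᵀ * R - G := by
      rw [Matrix.transpose_sub, hG, Matrix.transpose_mul, Matrix.transpose_transpose]
    conv_lhs => rw [← this, Matrix.transpose_apply]
  have key : ∀ j, R j j ≠ 0 ∧ (Rᵀ * R) j j ≤ 3 * g ∧ |(Rᵀ * R - G) j j| ≤ 40 * (e + γ * g) := by
    intro j
    induction j using WellFoundedLT.induction with
    | _ j ih =>
    have hpiv := pivot_lower_bound (g := 3 * g) (γ := 3 * γ) (e := e + 6 * (γ * g))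
      (η := 40 * (e + γ * g)) hG hQ hR (fun i hi => (ih i hi).1) (by positivity)
      (fun i hi => (ih i hi).2.1) (fun i hi => hO i j hi (ih i hi).1)
      (fun i hi k hk => by
        rcases lt_trichotomy i k with hik | rfl | hik
        · exact hE i k hik (ih i hi).1 (ih i hi).2.1 (ih k hk).2.1
        · exact (ih i hi).2.2
        · rw [hsymm]; exact hE k i hik (ih k hk).1 (ih k hk).2.1 (ih i hi).2.1)
      (by positivity) (by positivity) (by positivity)
      (by nlinarith [mul_nonneg (zero_le_one.trans hs1) he0,
        mul_nonneg (zero_le_one.trans hs1) hγg])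
    obtain ⟨t, ht, hz⟩ := hdiag j
    have ht' := ht.error_le hu hu1 (hcard j)
    have hσ : ∑ l ∈ Finset.Iio j, |R l j * R l j| = ∑ l ∈ Finset.Iio j, R l j ^ 2 :=
      Finset.sum_congr rfl fun l _ => by rw [← sq, abs_of_nonneg (sq_nonneg _)]
    simp only [neg_mul, abs_neg, Finset.sum_neg_distrib] at ht'
    rw [hσ] at ht'
    have hBj := transpose_mul_self_apply_of_upperTriangular hR j j
    simp only [← sq] at hBj ht'
    set ρ := ∑ l ∈ Finset.Iio j, R l j ^ 2 with hρ
    have hρ0 : 0 ≤ ρ := Finset.sum_nonneg fun _ _ => sq_nonneg _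
    have hGj := (le_abs_self _).trans (hGg j j)
    have hsγρ : s * (3 * γ) * ρ ≤ 1 / 100 * ρ :=
      mul_le_mul_of_nonneg_right (by linarith) hρ0
    have hρg : ρ ≤ 2 * g := by linarith
    have hsγρ' : s * (3 * γ) * ρ ≤ lam / 40 := by
      have h1 : s * (3 * γ) * ρ ≤ s * (3 * γ) * (2 * g) :=
        mul_le_mul_of_nonneg_left hρg (by positivity)
      have h2 : 0 ≤ s * e := by positivity
      nlinarith
    have hb : γ * (|H j j| + ρ) ≤ 4 * (γ * g) := by
      nlinarith [mul_le_mul_of_nonneg_left (add_le_add (hH j j) hρg) hγ]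
    have hHj := abs_le.1 (hHe j j)
    have htj := abs_le.1 (ht'.trans hb)
    have htpos : 0 < t := by linarith
    obtain ⟨hRpos, hsq⟩ := hz.sq_error_le hu (by linarith) htpos
    have hsq' := abs_le.1 hsq
    have htg : t ≤ 3 * g := by linarith
    have hut : u * t ≤ 3 * (γ * g) := by
      calc u * t ≤ γ * (3 * g) := mul_le_mul huγ htg htpos.le hγ
        _ = _ := by ring
    have hEj : |(Rᵀ * R - G) j j| ≤ 40 * (e + γ * g) := by
      rw [Matrix.sub_apply, hBj, abs_le]
      constructor <;> linarith [hsq'.1, hsq'.2]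
    refine ⟨hRpos.ne', ?_, hEj⟩
    rw [hBj]
    linarith
  refine ⟨fun i => (key i).1, ?_⟩
  refine (norm_le_of_abs_apply_le _ (b := 40 * (e + γ * g)) fun i k => ?_).trans_eq
    (by simp only [Fintype.card_fin]; ring)
  rcases lt_trichotomy i k with hik | rfl | hik
  · exact hE i k hik (key i).1 (key i).2.1 (key k).2.1
  · exact (key i).2.2
  · rw [hsymm]; exact hE k i hik (key k).1 (key k).2.1 (key i).2.1

end Cholesky

/-! ### Projections with a Pythagorean Cholesky factor -/

theorem norm_mul_le_of_le {l m n : Type*} [Fintype l] [Fintype m] [Fintype n] [DecidableEq m]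
    [DecidableEq n] {A : Matrix l m ℝ} {B : Matrix m n ℝ} {a b : ℝ} (hA : ‖A‖ ≤ a) (hB : ‖B‖ ≤ b) :
    ‖A * B‖ ≤ a * b :=
  (norm_matrix_mul_le A B).trans
    (mul_le_mul hA hB (norm_nonneg _) ((norm_nonneg _).trans hA))

theorem norm_le_add_of_sub_le {E : Type*} [SeminormedAddCommGroup E] {x y : E} {a b : ℝ}
    (h : ‖x - y‖ ≤ a) (hy : ‖y‖ ≤ b) : ‖x‖ ≤ a + b := by
  have := norm_add_le (x - y) y
  rw [sub_add_cancel] at this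
  linarith

section Projection

variable {m q n : Type*} [Fintype m] [Fintype q] [Fintype n] [DecidableEq q]

/-- A matrix with nearly orthonormal columns has a spectral norm of at most `2`. -/
theorem norm_le_two_of_orth {Q : Matrix m q ℝ} {ε : ℝ} (h : ‖1 - Qᵀ * Q‖ ≤ ε) (hε : ε ≤ 1) :
    ‖Q‖ ≤ 2 := by
  have h1 : ‖Qᵀ * Q‖ ≤ 1 + ε := by
    have := norm_le_add_of_sub_le (a := ε) ((norm_sub_rev _ _).trans_le h) (norm_one_le (n := q))
    linarith
  rw [norm_transpose_mul_self] at h1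
  nlinarith [norm_nonneg Q]

theorem norm_transpose_mul_self_sub_le [DecidableEq m] [DecidableEq n]
    {A B : Matrix m n ℝ} {a b e : ℝ} (hA : ‖A‖ ≤ a)
    (hB : ‖B‖ ≤ b) (he : ‖A - B‖ ≤ e) : ‖Aᵀ * A - Bᵀ * B‖ ≤ e * (a + b) := by
  have h : Aᵀ * A - Bᵀ * B = Aᵀ * (A - B) + (A - B)ᵀ * B := by
    rw [Matrix.transpose_sub, Matrix.mul_sub, Matrix.sub_mul]; abel
  rw [h]
  have h1 := norm_mul_le_of_le ((norm_transpose A).trans_le hA) he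
  have h2 := norm_mul_le_of_le ((norm_transpose (A - B)).trans_le he) hB
  exact (norm_add_le _ _).trans (by linarith)

/-- Up to the loss of orthogonality of `Q`, the Pythagorean expression `Xᵀ X - (Qᵀ X)ᵀ (Qᵀ X)` is
the Gram matrix of `(I - Q Qᵀ) X`. -/
theorem gram_projection_eq {n : Type*} (Q : Matrix m q ℝ) (X : Matrix m n ℝ) :
    (X - Q * (Qᵀ * X))ᵀ * (X - Q * (Qᵀ * X)) =
      Xᵀ * X - (Qᵀ * X)ᵀ * (Qᵀ * X) - (Qᵀ * X)ᵀ * (1 - Qᵀ * Q) * (Qᵀ * X) := by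
  simp only [Matrix.transpose_sub, Matrix.transpose_mul, Matrix.transpose_transpose, Matrix.sub_mul,
    Matrix.mul_sub, Matrix.mul_assoc, Matrix.mul_one]

theorem norm_gram_projection_sub_le [DecidableEq m] [DecidableEq n]
    {Q : Matrix m q ℝ} {X : Matrix m n ℝ} {ε N : ℝ}
    (hQ : ‖1 - Qᵀ * Q‖ ≤ ε) (hε1 : ε ≤ 1) (hX : ‖X‖ ≤ N) :
    ‖(X - Q * (Qᵀ * X))ᵀ * (X - Q * (Qᵀ * X)) - (Xᵀ * X - (Qᵀ * X)ᵀ * (Qᵀ * X))‖ ≤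
      4 * ε * N ^ 2 := by
  have hQ2 := norm_le_two_of_orth hQ hε1
  have hM := norm_mul_le_of_le ((norm_transpose Q).trans_le hQ2) hX
  have h := norm_mul_le_of_le (norm_mul_le_of_le ((norm_transpose (Qᵀ * X)).trans_le hM) hQ) hM
  rw [gram_projection_eq, sub_sub_cancel_left, norm_neg]
  linarith

/-- The heart of the stability analysis: if `R` is an approximate Cholesky factor of `Xᵀ X - Sᵀ S`,
where `S ≈ Qᵀ X`, then `U ≈ (X - Q S) R⁻¹` has nearly orthonormal columns, nearly orthogonal to
those of `Q`. All errors are measured by `ε`, and the quality of `U` depends on `ε N² / a`, where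
`N ≥ ‖X‖` and `√a` is, up to `ε`, a lower bound for the singular values of `(I - Q Qᵀ) X`. The
numerical constants are not sharp. -/
theorem projection_bounds [DecidableEq m] [DecidableEq n]
    {Q : Matrix m q ℝ} {X U : Matrix m n ℝ} {S : Matrix q n ℝ}
    {R : Matrix n n ℝ} {ε N a : ℝ} (hε1 : ε ≤ 1) (hQ : ‖1 - Qᵀ * Q‖ ≤ ε)
    (hX : ‖X‖ ≤ N) (hS : ‖S - Qᵀ * X‖ ≤ ε * N) (hR : ‖Rᵀ * R - (Xᵀ * X - Sᵀ * S)‖ ≤ ε * N ^ 2)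
    (hU : ‖U * R - (X - Q * S)‖ ≤ ε * (N + ‖U‖ * ‖R‖))
    (ha : 0 < a) (hLB : QuadLB a (Xᵀ * X - (Qᵀ * X)ᵀ * (Qᵀ * X)))
    (hsmall : 3000 * (ε * N ^ 2) ≤ a) :
    ‖U‖ ≤ 2 ∧ ‖R‖ ≤ 4 * N ∧ QuadLB (a / 2) (Rᵀ * R) ∧ ‖U * R - (X - Q * S)‖ ≤ 9 * (ε * N) ∧
      a * ‖1 - Uᵀ * U‖ ≤ 1200 * (ε * N ^ 2) ∧ a * ‖Qᵀ * U‖ ^ 2 ≤ 1400 * (ε * N) ^ 2 := by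
  have hε : 0 ≤ ε := (norm_nonneg _).trans hQ
  have hN : 0 ≤ N := (norm_nonneg _).trans hX
  have hεN : 0 ≤ ε * N := mul_nonneg hε hN
  have hεNN : ε * N ≤ N := by nlinarith
  have hεN2 : 0 ≤ ε * N ^ 2 := by positivity
  have hεNN2 : ε * N ^ 2 ≤ N ^ 2 := by nlinarith [sq_nonneg N]
  have hQ2 := norm_le_two_of_orth hQ hε1
  have hQt := (norm_transpose Q).trans_le hQ2
  set M := Qᵀ * X with hM
  have hM2 : ‖M‖ ≤ 2 * N := norm_mul_le_of_le hQt hX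
  have hS3 : ‖S‖ ≤ 3 * N := (norm_le_add_of_sub_le hS hM2).trans (by linarith)
  have hXX : ‖Xᵀ * X‖ ≤ N ^ 2 := by
    rw [norm_transpose_mul_self]; exact pow_le_pow_left₀ (norm_nonneg _) hX 2
  have hSS : ‖Sᵀ * S‖ ≤ 9 * N ^ 2 := by
    rw [norm_transpose_mul_self]
    exact (pow_le_pow_left₀ (norm_nonneg _) hS3 2).trans_eq (by ring)
  have hG : ‖Xᵀ * X - Sᵀ * S‖ ≤ 10 * N ^ 2 := (norm_sub_le _ _).trans (by linarith)
  have hR4 : ‖R‖ ≤ 4 * N := by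
    have h1 := norm_le_add_of_sub_le hR hG
    rw [norm_transpose_mul_self] at h1
    exact (sq_le_sq₀ (norm_nonneg _) (by positivity)).1 (by linarith [sq_nonneg N])
  have hSM : ‖(Xᵀ * X - Sᵀ * S) - (Xᵀ * X - Mᵀ * M)‖ ≤ 5 * (ε * N ^ 2) := by
    have h1 := norm_transpose_mul_self_sub_le hM2 hS3 ((norm_sub_rev _ _).trans_le hS)
    rw [sub_sub_sub_cancel_left]
    linarith
  have hRG : ‖Rᵀ * R - (Xᵀ * X - Mᵀ * M)‖ ≤ 6 * (ε * N ^ 2) := by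
    have h1 := norm_add_le (Rᵀ * R - (Xᵀ * X - Sᵀ * S))
      ((Xᵀ * X - Sᵀ * S) - (Xᵀ * X - Mᵀ * M))
    rw [sub_add_sub_cancel] at h1
    linarith
  have hRLB : QuadLB (a / 2) (Rᵀ * R) := (hLB.perturb hRG).mono (by linarith)
  set V := X - Q * M with hV
  have hV5 : ‖V‖ ≤ 5 * N := by
    have := norm_mul_le_of_le hQ2 hM2
    exact (norm_sub_le _ _).trans (by linarith)
  set y := ‖U‖ with hy
  have hy0 : 0 ≤ y := norm_nonneg _
  have hU' : ‖U * R - (X - Q * S)‖ ≤ ε * (N + 4 * N * y) := by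
    refine hU.trans (mul_le_mul_of_nonneg_left ?_ hε)
    linarith [mul_le_mul_of_nonneg_left hR4 hy0]
  have hD : ‖U * R - V‖ ≤ 4 * (ε * N) * (1 + y) := by
    have h1 : U * R - V = (U * R - (X - Q * S)) - Q * (S - M) := by
      rw [hV, Matrix.mul_sub]; abel
    have h2 := norm_mul_le_of_le hQ2 hS
    have h3 := norm_sub_le (U * R - (X - Q * S)) (Q * (S - M))
    rw [← h1] at h3
    linarith [mul_nonneg hεN hy0]
  have hUR : ‖U * R‖ ≤ 4 * N * (1 + y) + 5 * N := by
    refine (norm_le_add_of_sub_le hD hV5).trans ?_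
    have : ε * N * (1 + y) ≤ N * (1 + y) := mul_le_mul_of_nonneg_right hεNN (by linarith)
    linarith
  have hA : ‖(U * R)ᵀ * (U * R) - Vᵀ * V‖ ≤ 56 * (ε * N ^ 2) * (1 + y) ^ 2 := by
    refine (norm_transpose_mul_self_sub_le hUR hV5 hD).trans ?_
    have h1 : 4 * N * (1 + y) + 5 * N + 5 * N ≤ 14 * N * (1 + y) := by
      linarith [mul_nonneg hN hy0]
    calc _ ≤ 4 * (ε * N) * (1 + y) * (14 * N * (1 + y)) :=
          mul_le_mul_of_nonneg_left h1 (by positivity)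
      _ = _ := by ring
  have hB := norm_gram_projection_sub_le hQ hε1 hX
  rw [← hM, ← hV] at hB
  have hUU : ‖Rᵀ * (1 - Uᵀ * U) * R‖ ≤ 66 * (ε * N ^ 2) * (1 + y) ^ 2 := by
    have h1 : Rᵀ * (1 - Uᵀ * U) * R = (Rᵀ * R - (Xᵀ * X - Mᵀ * M)) -
        ((U * R)ᵀ * (U * R) - Vᵀ * V) - (Vᵀ * V - (Xᵀ * X - Mᵀ * M)) := by
      simp only [Matrix.transpose_mul, Matrix.mul_sub, Matrix.sub_mul, Matrix.mul_one,
        Matrix.mul_assoc]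
      abel
    rw [h1]
    refine (norm_sub_le _ _).trans ((add_le_add_left (norm_sub_le _ _) _).trans ?_)
    have h2 : 1 ≤ (1 + y) ^ 2 := one_le_pow₀ (by linarith)
    linarith [mul_le_mul_of_nonneg_left h2 hεN2]
  have hO : a * ‖1 - Uᵀ * U‖ ≤ 132 * (ε * N ^ 2) * (1 + y) ^ 2 := by
    have := (hRLB.mul_norm_le (by linarith) (1 - Uᵀ * U)).trans hUU
    linarith
  -- As `ε N² / a` is small, the last bound, which still depends on `‖U‖`, limits `‖U‖` itself.
  have hy2 : y ≤ 2 := by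
    have h1 : a * ‖1 - Uᵀ * U‖ ≤ a * ((1 + y) ^ 2 / 16) := by
      refine hO.trans ?_
      linarith [mul_le_mul_of_nonneg_right hsmall (sq_nonneg (1 + y)),
        mul_nonneg hεN2 (sq_nonneg (1 + y))]
    have h2 := le_of_mul_le_mul_left h1 ha
    rw [norm_sub_rev] at h2
    have h3 := norm_le_add_of_sub_le h2 norm_one_le
    rw [norm_transpose_mul_self, ← hy] at h3
    by_contra hc
    have h4 := mul_pos (sub_pos.2 (not_le.1 hc)) (by linarith : 0 < 15 * y + 28)
    linarith
  refine ⟨hy2, hR4, hRLB, ?_, ?_, ?_⟩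
  · refine hU'.trans ?_
    linarith [mul_le_mul_of_nonneg_left hy2 hεN]
  · refine hO.trans ?_
    have : (1 + y) ^ 2 ≤ (1 + 2) ^ 2 := pow_le_pow_left₀ (by linarith) (by linarith) 2
    linarith [mul_le_mul_of_nonneg_left this hεN2]
  · have h1 : Qᵀ * U * R = (1 - Qᵀ * Q) * M + Qᵀ * (U * R - V) := by
      simp only [hV, hM, Matrix.mul_sub, Matrix.sub_mul, Matrix.one_mul, Matrix.mul_assoc]
      abel
    have h2 : ‖Qᵀ * U * R‖ ≤ 26 * (ε * N) := by
      rw [h1]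
      have h3 := norm_mul_le_of_le hQ hM2
      have h4 := norm_mul_le_of_le hQt hD
      have h5 : ε * N * y ≤ ε * N * 2 := mul_le_mul_of_nonneg_left hy2 hεN
      exact (norm_add_le _ _).trans (by linarith)
    have h3 := hRLB.mul_norm_sq_le (by linarith) (Qᵀ * U)
    have h4 := pow_le_pow_left₀ (norm_nonneg _) h2 2
    rw [mul_pow] at h4
    linarith [sq_nonneg (ε * N)]

end Projection

theorem one_le_matConst {D : ℕ} (hD : 1 ≤ D) : 1 ≤ matConst D := by
  have h1 : (1 : ℝ) ≤ 2 ^ (D + 2) := one_le_pow₀ (by norm_num)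
  have h2 : (1 : ℝ) ≤ D := by exact_mod_cast hD
  have h3 : (1 : ℝ) ≤ D ^ 2 := one_le_pow₀ h2
  unfold matConst
  nlinarith [mul_nonneg (sub_nonneg.2 h1) (sub_nonneg.2 h3)]

theorem gam_le_matConst {D : ℕ} (hD : 1 ≤ D) {u : ℝ} (hu : 0 ≤ u) : gam D u ≤ matConst D * u := by
  have h2 : (1 : ℝ) ≤ D := by exact_mod_cast hD
  have h3 : (1 : ℝ) ≤ D ^ 2 := one_le_pow₀ h2
  have h4 : (1 : ℝ) ≤ 3 * (D ^ 2 * (D + 1)) := by nlinarith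
  unfold gam matConst
  calc _ = 2 ^ (D + 2) * u * 1 := by ring
    _ ≤ 2 ^ (D + 2) * u * (3 * (D ^ 2 * (D + 1))) := by gcongr
    _ = _ := by ring

/-- The error constant of a Pythagorean projection of matrices with at most `D` rows and
columns. -/
noncomputable def projConst (D : ℕ) : ℝ := 1000 * (D : ℝ) ^ 2 * matConst D

theorem matConst_le_projConst {D : ℕ} (hD : 1 ≤ D) : 1000 * matConst D ≤ projConst D := by
  have h3 : (1 : ℝ) ≤ (D : ℝ) ^ 2 := one_le_pow₀ (by exact_mod_cast hD)
  unfold projConst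
  nlinarith [matConst_nonneg D]

/-- `projection_bounds` for quantities computed in floating-point arithmetic. -/
theorem fl_projection_bounds {q : Type*} [Fintype q] [DecidableEq q] {m s D : ℕ} (hD : 1 ≤ D)
    (hm : m ≤ D) (hs : s ≤ D) (hq : Fintype.card q ≤ D) {u : ℝ} (hu : 0 ≤ u)
    {Q : Matrix (Fin m) q ℝ} {X U V : Matrix (Fin m) (Fin s) ℝ} {S : Matrix q (Fin s) ℝ}
    {T H R : Matrix (Fin s) (Fin s) ℝ} {κ ε N a : ℝ}
    (hε : ε = (κ + projConst D) * u) (hε1 : ε ≤ 1) (hQ : ‖1 - Qᵀ * Q‖ ≤ κ * u)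
    (hX : ‖X‖ ≤ N) (hS : ‖S - Qᵀ * X‖ ≤ κ * u * N) (hT : FlMul u Xᵀ X T)
    (hH : FlSubMul u T Sᵀ S H) (hR : FlChol u H R) (hV : FlSubMul u X Q S V)
    (hU : FlSolve u V R U) (ha : 0 < a) (hLB : QuadLB a (Xᵀ * X - (Qᵀ * X)ᵀ * (Qᵀ * X)))
    (hsmall : 3000 * (ε * N ^ 2) ≤ a) :
    (∀ i, R i i ≠ 0) ∧
    ‖U‖ ≤ 2 ∧ ‖R‖ ≤ 4 * N ∧ QuadLB (a / 2) (Rᵀ * R) ∧ ‖U * R - (X - Q * S)‖ ≤ 9 * (ε * N) ∧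
      a * ‖1 - Uᵀ * U‖ ≤ 1200 * (ε * N ^ 2) ∧ a * ‖Qᵀ * U‖ ^ 2 ≤ 1400 * (ε * N) ^ 2 := by
  have hs' : Fintype.card (Fin s) ≤ D := by simpa using hs
  have hm' : Fintype.card (Fin m) ≤ D := by simpa using hm
  have hN : 0 ≤ N := (norm_nonneg _).trans hX
  have hD1 : (1 : ℝ) ≤ D := by exact_mod_cast hD
  have hκ0 : 0 ≤ κ * u := (norm_nonneg _).trans hQ
  set δ := matConst D * u with hδ
  have hδ0 : 0 ≤ δ := mul_nonneg (matConst_nonneg D) hu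
  have hP : projConst D * u = 1000 * (D : ℝ) ^ 2 * δ := by rw [projConst, hδ]; ring
  have hε' : ε = κ * u + 1000 * (D : ℝ) ^ 2 * δ := by rw [hε, add_mul, hP]
  have hDD : (D : ℝ) ≤ (D : ℝ) ^ 2 := by nlinarith
  have hDδ : D * δ ≤ (D : ℝ) ^ 2 * δ := mul_le_mul_of_nonneg_right hDD hδ0
  have hδD : δ ≤ D * δ := by nlinarith
  have hδε : 1000 * δ ≤ ε := by linarith
  have hκε : κ * u ≤ ε := by nlinarith
  have hδ1 : δ ≤ 1 := by linarith
  have hu1 : u ≤ 1 := by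
    have := one_le_matConst hD
    nlinarith
  have hε0 : 0 ≤ ε := hκ0.trans hκε
  have hQ2 := norm_le_two_of_orth hQ (hκε.trans hε1)
  have hQt := (norm_transpose Q).trans_le hQ2
  have hM2 : ‖Qᵀ * X‖ ≤ 2 * N := norm_mul_le_of_le hQt hX
  have hS3 : ‖S‖ ≤ 3 * N := by
    refine (norm_le_add_of_sub_le hS hM2).trans ?_
    have : κ * u * N ≤ 1 * N := mul_le_mul_of_nonneg_right (hκε.trans hε1) hN
    linarith
  have hXX : ‖Xᵀ * X‖ ≤ N ^ 2 := by
    rw [norm_transpose_mul_self]; exact pow_le_pow_left₀ (norm_nonneg _) hX 2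
  have hXX' : ‖Xᵀ‖ * ‖X‖ ≤ N ^ 2 := by
    rw [norm_transpose, ← sq]; exact pow_le_pow_left₀ (norm_nonneg _) hX 2
  have hSS' : ‖Sᵀ‖ * ‖S‖ ≤ 9 * N ^ 2 := by
    rw [norm_transpose, ← sq]
    exact (pow_le_pow_left₀ (norm_nonneg _) hS3 2).trans_eq (by ring)
  have hSS : ‖Sᵀ * S‖ ≤ 9 * N ^ 2 := (norm_matrix_mul_le _ _).trans hSS'
  have hG : ‖Xᵀ * X - Sᵀ * S‖ ≤ 10 * N ^ 2 := (norm_sub_le _ _).trans (by linarith)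
  have hTe : ‖T - Xᵀ * X‖ ≤ δ * N ^ 2 :=
    (hT.error_le hs' hm' hs' hu hu1).trans (mul_le_mul_of_nonneg_left hXX' hδ0)
  have hδN : 0 ≤ δ * N ^ 2 := by positivity
  have hδN1 : δ * N ^ 2 ≤ N ^ 2 := by nlinarith [sq_nonneg N]
  have hTn : ‖T‖ ≤ 2 * N ^ 2 := (norm_le_add_of_sub_le hTe hXX).trans (by linarith)
  have hHe : ‖H - (Xᵀ * X - Sᵀ * S)‖ ≤ 12 * (δ * N ^ 2) := by
    have h1 : H - (Xᵀ * X - Sᵀ * S) = (H - (T - Sᵀ * S)) + (T - Xᵀ * X) := by abel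
    have h2 := hH.error_le hs' hq hs' hu hu1
    have h3 : δ * (‖T‖ + ‖Sᵀ‖ * ‖S‖) ≤ δ * (2 * N ^ 2 + 9 * N ^ 2) :=
      mul_le_mul_of_nonneg_left (add_le_add hTn hSS') hδ0
    rw [h1]
    exact (norm_add_le _ _).trans (by linarith)
  have hG0 : (Xᵀ * X - Sᵀ * S)ᵀ = Xᵀ * X - Sᵀ * S := by
    simp [Matrix.transpose_mul]
  have hεN2 : 0 ≤ ε * N ^ 2 := by positivity
  have hGLB : QuadLB (a / 2) (Xᵀ * X - Sᵀ * S) := by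
    have h1 := norm_transpose_mul_self_sub_le hM2 hS3 ((norm_sub_rev _ _).trans_le hS)
    have h2 : ‖(Xᵀ * X - Sᵀ * S) - (Xᵀ * X - (Qᵀ * X)ᵀ * (Qᵀ * X))‖ ≤ 5 * (ε * N ^ 2) := by
      rw [sub_sub_sub_cancel_left]
      refine h1.trans ?_
      have : κ * u * N ^ 2 ≤ ε * N ^ 2 := mul_le_mul_of_nonneg_right hκε (sq_nonneg N)
      linarith
    exact (hLB.perturb h2).mono (by linarith)
  have hgam : gam D u * (10 * N ^ 2) ≤ 10 * (δ * N ^ 2) := by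
    have := mul_le_mul_of_nonneg_right (gam_le_matConst hD hu) (sq_nonneg N)
    linarith
  have hgam0 : 0 ≤ gam D u * (10 * N ^ 2) := mul_nonneg (gam_nonneg hu) (by positivity)
  have hsD : (s : ℝ) ≤ D := by exact_mod_cast hs
  have hDδN : D * (δ * N ^ 2) ≤ (D : ℝ) ^ 2 * (δ * N ^ 2) := mul_le_mul_of_nonneg_right hDD hδN
  have hD2δN : 1000 * ((D : ℝ) ^ 2 * (δ * N ^ 2)) ≤ ε * N ^ 2 := by
    rw [hε']
    nlinarith [mul_nonneg hκ0 (sq_nonneg N)]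
  obtain ⟨hdiag, hchol⟩ := hR.spec hs hu hu1 hG0 hG hHe (half_pos ha) hGLB (by
    calc 400 * s * (12 * (δ * N ^ 2) + gam D u * (10 * N ^ 2))
        ≤ 400 * D * (22 * (δ * N ^ 2)) := by
          refine mul_le_mul (by linarith) (by linarith) (by positivity) (by positivity)
      _ ≤ a / 2 := by linarith)
  refine ⟨hdiag, projection_bounds hε1 (hQ.trans hκε) hX
    (hS.trans (mul_le_mul_of_nonneg_right hκε hN)) ?_ ?_ ha hLB hsmall⟩
  · refine hchol.trans ?_
    have h1 : (s : ℝ) ^ 2 ≤ (D : ℝ) ^ 2 := pow_le_pow_left₀ (by positivity) hsD 2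
    calc (s : ℝ) ^ 2 * (40 * (12 * (δ * N ^ 2) + gam D u * (10 * N ^ 2)))
        ≤ (D : ℝ) ^ 2 * (1000 * (δ * N ^ 2)) :=
          mul_le_mul h1 (by linarith) (by positivity) (by positivity)
      _ ≤ _ := by linarith
  · have h1 := hV.error_le hm' hq hs' hu hu1
    have h2 : ‖Q‖ * ‖S‖ ≤ 2 * (3 * N) :=
      mul_le_mul hQ2 hS3 (norm_nonneg _) (by norm_num)
    have h3 : ‖V - (X - Q * S)‖ ≤ 7 * (δ * N) := by
      refine h1.trans ?_
      have := mul_le_mul_of_nonneg_left (add_le_add hX h2) hδ0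
      linarith
    have hδNN : δ * N ≤ 1 * N := mul_le_mul_of_nonneg_right hδ1 hN
    have h4 : ‖V‖ ≤ 14 * N := by
      have h5 : ‖X - Q * S‖ ≤ 7 * N := (norm_sub_le _ _).trans
        (by linarith [norm_matrix_mul_le Q S])
      exact (norm_le_add_of_sub_le h3 h5).trans (by linarith)
    have h5 := hU.error_le hm' hs hu hu1 hR.1 hdiag
    have h6 := norm_add_le (U * R - V) (V - (X - Q * S))
    rw [sub_add_sub_cancel] at h6
    have h7 : 0 ≤ ‖U‖ * ‖R‖ := by positivity
    have h8 := mul_le_mul_of_nonneg_left h4 hδ0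
    have h9 := mul_le_mul_of_nonneg_right hδε hN
    have h10 := mul_le_mul_of_nonneg_right hδε h7
    have h11 : 0 ≤ δ * (‖U‖ * ‖R‖) := by positivity
    have h12 : 0 ≤ δ * N := by positivity
    linarith

/-! ### One step of the block method -/

section Step

variable {q : Type*} [Fintype q] [DecidableEq q] {m s D : ℕ} {u : ℝ}

/-- Orthogonality after both projections of a block. The first one loses orthogonality in proportion
to `κ²`, but leaves a well-conditioned `U`, so that the second one attains the level `ε`. -/
theorem fl_two_projections (hD : 1 ≤ D) (hm : m ≤ D) (hs : s ≤ D) (hq : Fintype.card q ≤ D)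
    (hu : 0 ≤ u) {Q : Matrix (Fin m) q ℝ} {X U V Q' W : Matrix (Fin m) (Fin s) ℝ}
    {S Y : Matrix q (Fin s) ℝ} {T H R Ω K R' : Matrix (Fin s) (Fin s) ℝ} {κ ε N σ : ℝ}
    (hε : ε = (κ + 2 * projConst D) * u) (hε1 : 10 ^ 6 * ε ≤ 1)
    (hσ : 0 < σ) (hsmall : 10 ^ 6 * (ε * N ^ 2) ≤ σ ^ 2)
    (hQ : ‖1 - Qᵀ * Q‖ ≤ κ * u) (hX : ‖X‖ ≤ N) (hS : ‖S - Qᵀ * X‖ ≤ κ * u * N)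
    (hLB : QuadLB ((σ / 2) ^ 2) ((X - Q * (Qᵀ * X))ᵀ * (X - Q * (Qᵀ * X))))
    (hT : FlMul u Xᵀ X T) (hH : FlSubMul u T Sᵀ S H) (hR : FlChol u H R)
    (hV : FlSubMul u X Q S V) (hU : FlSolve u V R U)
    (hY : FlMul u Qᵀ U Y) (hΩ : FlMul u Uᵀ U Ω) (hK : FlSubMul u Ω Yᵀ Y K) (hR' : FlChol u K R')
    (hW : FlSubMul u U Q Y W) (hQ' : FlSolve u W R' Q') :
    ((∀ i, R' i i ≠ 0) ∧ ‖R'‖ ≤ 8 ∧ QuadLB (1 / 4) (R'ᵀ * R')) ∧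
    (‖U‖ ≤ 2 ∧ ‖R‖ ≤ 4 * N ∧ ‖S‖ ≤ 3 * N ∧ ‖Y‖ ≤ 6) ∧
    (‖U * R - (X - Q * S)‖ ≤ 9 * (ε * N) ∧ ‖Q' * R' - (U - Q * Y)‖ ≤ 18 * ε) ∧
    ‖1 - Q'ᵀ * Q'‖ ≤ 9600 * ε ∧ ‖Qᵀ * Q'‖ ≤ 110 * ε := by
  have hN : 0 ≤ N := (norm_nonneg _).trans hX
  have hP0 : 0 ≤ projConst D * u := by
    have := matConst_nonneg D
    unfold projConst; positivity
  have hκ0 : 0 ≤ κ * u := (norm_nonneg _).trans hQ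
  set δ := matConst D * u with hδ
  have hδ0 : 0 ≤ δ := mul_nonneg (matConst_nonneg D) hu
  have hδP : 1000 * δ ≤ projConst D * u := by
    have := mul_le_mul_of_nonneg_right (matConst_le_projConst hD) hu
    linarith
  have hu1 : u ≤ 1 := by
    have := mul_le_mul_of_nonneg_right (one_le_matConst hD) hu
    linarith
  set ε₁ := (κ + projConst D) * u with hε₁
  have hε12 : ε = ε₁ + projConst D * u := by rw [hε, hε₁]; ring
  have hε1' : ε₁ = κ * u + projConst D * u := by rw [hε₁]; ring
  have hε₁0 : 0 ≤ ε₁ := by linarith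
  have hle : ε₁ ≤ ε := by linarith
  have hle2 : ε₁ * N ^ 2 ≤ ε * N ^ 2 := mul_le_mul_of_nonneg_right hle (sq_nonneg N)
  have hleN : ε₁ * N ≤ ε * N := mul_le_mul_of_nonneg_right hle hN
  have hσ2 : 0 < σ ^ 2 := by positivity
  have hεN2 : 0 ≤ ε₁ * N ^ 2 := by positivity
  have hQ2 := norm_le_two_of_orth hQ (by linarith)
  have hQt := (norm_transpose Q).trans_le hQ2
  have hS3 : ‖S‖ ≤ 3 * N := by
    refine (norm_le_add_of_sub_le hS (norm_mul_le_of_le hQt hX)).trans ?_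
    have : κ * u * N ≤ 1 * N := mul_le_mul_of_nonneg_right (by linarith) hN
    linarith
  have hLB1 : QuadLB (σ ^ 2 / 8) (Xᵀ * X - (Qᵀ * X)ᵀ * (Qᵀ * X)) := by
    have h1 := norm_gram_projection_sub_le hQ (by linarith) hX
    rw [norm_sub_rev] at h1
    have h2 : κ * u * N ^ 2 ≤ ε * N ^ 2 := mul_le_mul_of_nonneg_right (by linarith) (sq_nonneg N)
    refine (hLB.perturb h1).mono ?_
    linarith
  obtain ⟨-, hU2, hR4, -, hUR, hUU, hQU⟩ := fl_projection_bounds (a := σ ^ 2 / 8) hD hm hs hq hu hε₁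
    (by linarith) hQ hX hS hT hH hR hV hU (by positivity) hLB1 (by linarith)
  have hUU' : ‖1 - Uᵀ * U‖ ≤ 1 / 4 := by
    have h1 : σ ^ 2 / 8 * ‖1 - Uᵀ * U‖ ≤ σ ^ 2 / 8 * (1 / 4) := by linarith
    exact le_of_mul_le_mul_left h1 (by positivity)
  have hQU' : ‖Qᵀ * U‖ ^ 2 ≤ 1 / 4 := by
    have h1 : (ε₁ * N) ^ 2 ≤ 1 * (ε₁ * N ^ 2) := by
      calc (ε₁ * N) ^ 2 = ε₁ * (ε₁ * N ^ 2) := by ring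
        _ ≤ _ := mul_le_mul_of_nonneg_right (by linarith) hεN2
    have h2 : σ ^ 2 / 8 * ‖Qᵀ * U‖ ^ 2 ≤ σ ^ 2 / 8 * (1 / 4) := by linarith
    exact le_of_mul_le_mul_left h2 (by positivity)
  have hY' : ‖Y - Qᵀ * U‖ ≤ 4 * δ := by
    have h1 := hY.error_le hq (by simpa using hm) (by simpa using hs) hu hu1
    have h2 : ‖Qᵀ‖ * ‖U‖ ≤ 2 * 2 := mul_le_mul hQt hU2 (norm_nonneg _) (by norm_num)
    have h3 := mul_le_mul_of_nonneg_left h2 hδ0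
    linarith
  have hY6 : ‖Y‖ ≤ 6 := (norm_le_add_of_sub_le hY' (norm_mul_le_of_le hQt hU2)).trans (by linarith)
  have hLB2 : QuadLB (1 / 2) (Uᵀ * U - (Qᵀ * U)ᵀ * (Qᵀ * U)) := by
    have h1 : QuadLB 1 (1 : Matrix (Fin s) (Fin s) ℝ) := fun v => by simp
    have h2 : ‖Uᵀ * U - (Qᵀ * U)ᵀ * (Qᵀ * U) - 1‖ ≤ 1 / 4 + 1 / 4 := by
      have h3 := norm_add_le (1 - Uᵀ * U) ((Qᵀ * U)ᵀ * (Qᵀ * U))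
      rw [norm_transpose_mul_self] at h3
      rw [← norm_neg]
      refine le_trans (le_of_eq ?_) (h3.trans (add_le_add hUU' hQU'))
      congr 1; abel
    exact (h1.perturb h2).mono (by norm_num)
  obtain ⟨hd, -, hR8, hRLB, hQR, hQQ, hQQ'⟩ := fl_projection_bounds (κ := κ + projConst D) (ε := ε)
    (N := 2) (a := 1 / 2) (Q := Q) hD hm hs hq hu (by rw [hε]; ring) (by linarith)
    (hQ.trans (by linarith)) hU2 (hY'.trans (by linarith)) hΩ hK hR' hW hQ' (by norm_num) hLB2
    (by linarith)
  refine ⟨⟨hd, by linarith, hRLB.mono (by norm_num)⟩, ⟨hU2, hR4, hS3, hY6⟩,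
    ⟨by linarith, by linarith⟩, by linarith, ?_⟩
  refine (sq_le_sq₀ (norm_nonneg _) (by linarith)).1 ?_
  linarith [sq_nonneg ε]

/-- The block column `Q' R' ≈ U - Q Y` of the factorization reproduces `X`. -/
theorem fl_residual_bound (hD : 1 ≤ D) (hs : s ≤ D) (hq : Fintype.card q ≤ D)
    (hu : 0 ≤ u) {Q : Matrix (Fin m) q ℝ} {X U Q' : Matrix (Fin m) (Fin s) ℝ}
    {S Y B : Matrix q (Fin s) ℝ} {R R' B' : Matrix (Fin s) (Fin s) ℝ} {ε N : ℝ}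
    (hδε : 1000 * (matConst D * u) ≤ ε) (hε1 : ε ≤ 1)
    (hQ : ‖Q‖ ≤ 2) (hQ' : ‖Q'‖ ≤ 2) (hR : ‖R‖ ≤ 4 * N) (hR' : ‖R'‖ ≤ 8)
    (hS : ‖S‖ ≤ 3 * N) (hY : ‖Y‖ ≤ 6) (hUR : ‖U * R - (X - Q * S)‖ ≤ 9 * (ε * N))
    (hQR : ‖Q' * R' - (U - Q * Y)‖ ≤ 18 * ε)
    (hB : FlAddMul u S Y R B) (hB' : FlMul u R' R B') :
    ‖X - (Q * B + Q' * B')‖ ≤ 200 * (ε * N) := by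
  have hN : 0 ≤ N := by linarith [(norm_nonneg _).trans hR]
  have hs' : Fintype.card (Fin s) ≤ D := by simpa using hs
  set δ := matConst D * u with hδ
  have hδ0 : 0 ≤ δ := mul_nonneg (matConst_nonneg D) hu
  have hu1 : u ≤ 1 := by
    have := mul_le_mul_of_nonneg_right (one_le_matConst hD) hu
    linarith
  have h1 : ‖B - (S + Y * R)‖ ≤ 27 * (δ * N) := by
    refine (hB.error_le hq hs' hs' hu hu1).trans ?_
    have h2 : ‖Y‖ * ‖R‖ ≤ 6 * (4 * N) := mul_le_mul hY hR (norm_nonneg _) (by norm_num)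
    have h3 := mul_le_mul_of_nonneg_left (add_le_add hS h2) hδ0
    linarith
  have h2 : ‖B' - R' * R‖ ≤ 32 * (δ * N) := by
    refine (hB'.error_le hs' hs' hs' hu hu1).trans ?_
    have h2 : ‖R'‖ * ‖R‖ ≤ 8 * (4 * N) := mul_le_mul hR' hR (norm_nonneg _) (by norm_num)
    have h3 := mul_le_mul_of_nonneg_left h2 hδ0
    linarith
  have h3 : X - (Q * B + Q' * B') = -(U * R - (X - Q * S)) - (Q' * R' - (U - Q * Y)) * R -
      Q * (B - (S + Y * R)) - Q' * (B' - R' * R) := by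
    simp only [Matrix.mul_sub, Matrix.sub_mul, Matrix.mul_add, Matrix.mul_assoc]
    abel
  have h4 := norm_mul_le_of_le hQR hR
  have h5 := norm_mul_le_of_le hQ h1
  have h6 := norm_mul_le_of_le hQ' h2
  have h7 := mul_le_mul_of_nonneg_right hδε hN
  have h8 : 0 ≤ ε * N := mul_nonneg (by linarith) hN
  rw [h3]
  refine (norm_sub_le _ _).trans ((add_le_add_left ((norm_sub_le _ _).trans (add_le_add_left
    (norm_sub_le _ _) _)) _).trans ?_)
  rw [norm_neg]
  linarith

/-- The coefficients `L ≈ Q'ᵀ X` are obtained from `P ≈ Uᵀ X` and `Z ≈ Qᵀ X`, which do not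
involve `Q'`, since `R'ᵀ Q'ᵀ X ≈ (U - Q Y)ᵀ X`. -/
theorem fl_delayed_coefficient_bound (hD : 1 ≤ D) (hm : m ≤ D) (hs : s ≤ D)
    (hq : Fintype.card q ≤ D)
    (hu : 0 ≤ u) {Q : Matrix (Fin m) q ℝ} {X U Q' : Matrix (Fin m) (Fin s) ℝ}
    {Y Z : Matrix q (Fin s) ℝ} {R' P J L : Matrix (Fin s) (Fin s) ℝ} {ε N : ℝ}
    (hδε : 1000 * (matConst D * u) ≤ ε) (hε1 : ε ≤ 1)
    (hQ : ‖Q‖ ≤ 2) (hQ' : ‖Q'‖ ≤ 2) (hU : ‖U‖ ≤ 2) (hX : ‖X‖ ≤ N) (hR' : ‖R'‖ ≤ 8)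
    (hY : ‖Y‖ ≤ 6) (hQR : ‖Q' * R' - (U - Q * Y)‖ ≤ 18 * ε)
    (htri : ∀ i j, j < i → R' i j = 0) (hd : ∀ i, R' i i ≠ 0) (hLB : QuadLB (1 / 4) (R'ᵀ * R'))
    (hZ : FlMul u Qᵀ X Z) (hP : FlMul u Uᵀ X P) (hJ : FlSubMul u P Yᵀ Z J)
    (hL : FlSolve u Jᵀ R' Lᵀ) : ‖L - Q'ᵀ * X‖ ≤ 100 * (ε * N) := by
  have hN : 0 ≤ N := (norm_nonneg _).trans hX
  have hs' : Fintype.card (Fin s) ≤ D := by simpa using hs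
  have hm' : Fintype.card (Fin m) ≤ D := by simpa using hm
  set δ := matConst D * u with hδ
  have hδ0 : 0 ≤ δ := mul_nonneg (matConst_nonneg D) hu
  have hu1 : u ≤ 1 := by
    have := mul_le_mul_of_nonneg_right (one_le_matConst hD) hu
    linarith
  have hδN0 : 0 ≤ δ * N := by positivity
  have hδN : δ * N ≤ 1 * N := mul_le_mul_of_nonneg_right (by linarith) hN
  have hZe : ‖Z - Qᵀ * X‖ ≤ 2 * (δ * N) := by
    refine (hZ.error_le hq hm' hs' hu hu1).trans ?_
    have h2 : ‖Qᵀ‖ * ‖X‖ ≤ 2 * N :=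
      mul_le_mul ((norm_transpose Q).trans_le hQ) hX (norm_nonneg _) (by norm_num)
    linarith [mul_le_mul_of_nonneg_left h2 hδ0]
  have hPe : ‖P - Uᵀ * X‖ ≤ 2 * (δ * N) := by
    refine (hP.error_le hs' hm' hs' hu hu1).trans ?_
    have h2 : ‖Uᵀ‖ * ‖X‖ ≤ 2 * N :=
      mul_le_mul ((norm_transpose U).trans_le hU) hX (norm_nonneg _) (by norm_num)
    linarith [mul_le_mul_of_nonneg_left h2 hδ0]
  have hZ4 : ‖Z‖ ≤ 4 * N := (norm_le_add_of_sub_le hZe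
    (norm_mul_le_of_le ((norm_transpose Q).trans_le hQ) hX)).trans (by linarith)
  have hP4 : ‖P‖ ≤ 4 * N := (norm_le_add_of_sub_le hPe
    (norm_mul_le_of_le ((norm_transpose U).trans_le hU) hX)).trans (by linarith)
  have hYt := (norm_transpose Y).trans_le hY
  have hYZ : ‖Yᵀ‖ * ‖Z‖ ≤ 6 * (4 * N) := mul_le_mul hYt hZ4 (norm_nonneg _) (by norm_num)
  have hJe : ‖J - (P - Yᵀ * Z)‖ ≤ 28 * (δ * N) := by
    refine (hJ.error_le hs' hq hs' hu hu1).trans ?_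
    linarith [mul_le_mul_of_nonneg_left (add_le_add hP4 hYZ) hδ0]
  have hJ56 : ‖J‖ ≤ 56 * N := (norm_le_add_of_sub_le hJe ((norm_sub_le _ _).trans
    (add_le_add hP4 ((norm_matrix_mul_le _ _).trans hYZ)))).trans (by linarith)
  have hLe := hL.error_le hs' hs hu hu1 htri hd
  rw [norm_transpose, norm_transpose] at hLe
  set E := L - Q'ᵀ * X with hE
  have hL' : ‖L‖ ≤ ‖E‖ + 2 * N := norm_le_add_of_sub_le le_rfl
    (norm_mul_le_of_le ((norm_transpose Q').trans_le hQ') hX)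
  have hER : Eᵀ * R' = (Lᵀ * R' - Jᵀ) + (J - (P - Yᵀ * Z))ᵀ + (P - Uᵀ * X)ᵀ -
      (Z - Qᵀ * X)ᵀ * Y - Xᵀ * (Q' * R' - (U - Q * Y)) := by
    simp only [hE, Matrix.transpose_sub, Matrix.transpose_mul, Matrix.transpose_transpose,
      Matrix.mul_sub, Matrix.sub_mul, Matrix.mul_assoc]
    abel
  have hE0 : 0 ≤ ‖E‖ := norm_nonneg _
  have hLe' : ‖Lᵀ * R' - Jᵀ‖ ≤ 72 * (δ * N) + 1 / 4 * ‖E‖ := by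
    refine hLe.trans ?_
    have h1 : ‖L‖ * ‖R'‖ ≤ (‖E‖ + 2 * N) * 8 :=
      mul_le_mul hL' hR' (norm_nonneg _) (by positivity)
    have h2 := mul_le_mul_of_nonneg_left (add_le_add hJ56 h1) hδ0
    have h3 : δ * ‖E‖ ≤ 1 / 1000 * ‖E‖ := mul_le_mul_of_nonneg_right (by linarith) hE0
    linarith
  have h1 := norm_mul_le_of_le ((norm_transpose (Z - Qᵀ * X)).trans_le hZe) hY
  have h2 := norm_mul_le_of_le ((norm_transpose X).trans_le hX) hQR
  have h3 : ‖Eᵀ * R'‖ ≤ 114 * (δ * N) + 18 * (ε * N) + 1 / 4 * ‖E‖ := by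
    rw [hER]
    refine (norm_sub_le _ _).trans ((add_le_add_left ((norm_sub_le _ _).trans (add_le_add_left
      (norm_add₃_le) _)) _).trans ?_)
    rw [norm_transpose, norm_transpose]
    linarith
  have h4 := hLB.mul_norm_sq_le (by norm_num) Eᵀ
  rw [norm_transpose] at h4
  have h5 : 1 / 2 * ‖E‖ ≤ ‖Eᵀ * R'‖ :=
    (sq_le_sq₀ (by positivity) (norm_nonneg _)).1 (by linarith)
  have h6 := mul_le_mul_of_nonneg_right hδε hN
  have h7 : 0 ≤ ε * N := mul_nonneg (by linarith) hN
  linarith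

end Step

/-- Lower bound for the projected block: if `A ≈ Q R` and `[A, B]` has singular values of at least
`σ`, then `B - Q M` has singular values of at least `σ / 2` for every `M`, since it takes the same
values as `[A, B]` up to the residual `A - Q R`. -/
theorem quadLB_projection {m q n : Type*} [Fintype m] [Fintype q] [Fintype n]
    [DecidableEq q] [DecidableEq n] {Q A : Matrix m q ℝ} {R : Matrix q q ℝ} {B : Matrix m n ℝ}
    {σ d : ℝ} (hσ : 0 < σ)
    (h : ∀ z w, σ * √(vecNorm z ^ 2 + vecNorm w ^ 2) ≤ vecNorm (A *ᵥ z + B *ᵥ w))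
    (hAQ : ‖A - Q * R‖ ≤ d) (hd : d ≤ σ / 2) (M : Matrix q n ℝ) :
    QuadLB ((σ / 2) ^ 2) ((B - Q * M)ᵀ * (B - Q * M)) := by
  have hR : IsUnit R := by
    rw [← Matrix.mulVec_injective_iff_isUnit, ← Matrix.coe_mulVecLin,
      injective_iff_map_eq_zero]
    intro z hz
    have hz' : R *ᵥ z = 0 := hz
    have h1 := h z 0
    have h2 : A *ᵥ z = (A - Q * R) *ᵥ z := by
      rw [Matrix.sub_mulVec, ← Matrix.mulVec_mulVec, hz', Matrix.mulVec_zero, sub_zero]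
    have h3 := vecNorm_mulVec_le (A - Q * R) z
    have h4 : vecNorm (0 : n → ℝ) ^ 2 = 0 := by rw [vecNorm_sq, dotProduct_zero]
    rw [h4, add_zero, Real.sqrt_sq (vecNorm_nonneg z), Matrix.mulVec_zero, add_zero, h2] at h1
    have h5 := mul_le_mul_of_nonneg_right (hAQ.trans hd) (vecNorm_nonneg z)
    have h6 : vecNorm z = 0 := by
      by_contra hne
      have := mul_pos hσ ((vecNorm_nonneg z).lt_of_ne' hne)
      linarith
    have h7 := vecNorm_sq z
    rw [h6, sq, mul_zero] at h7
    exact dotProduct_self_eq_zero.1 h7.symm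
  refine quadLB_transpose_mul_self_of_le (by positivity) fun v => ?_
  obtain ⟨z, hz⟩ := (Matrix.mulVec_surjective_iff_isUnit.2 hR) (-(M *ᵥ v))
  have h1 := h z v
  have h2 : A *ᵥ z + B *ᵥ v = (B - Q * M) *ᵥ v + (A - Q * R) *ᵥ z := by
    rw [Matrix.sub_mulVec, Matrix.sub_mulVec, ← Matrix.mulVec_mulVec, ← Matrix.mulVec_mulVec, hz,
      Matrix.mulVec_neg]
    abel
  have h3 := vecNorm_add_le ((B - Q * M) *ᵥ v) ((A - Q * R) *ᵥ z)
  rw [← h2] at h3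
  have h4 := vecNorm_mulVec_le (A - Q * R) z
  have h5 : vecNorm z ≤ √(vecNorm z ^ 2 + vecNorm v ^ 2) :=
    Real.le_sqrt_of_sq_le (by linarith [sq_nonneg (vecNorm v)])
  have h6 : vecNorm v ≤ √(vecNorm z ^ 2 + vecNorm v ^ 2) :=
    Real.le_sqrt_of_sq_le (by linarith [sq_nonneg (vecNorm z)])
  have h7 := mul_le_mul (hAQ.trans hd) h5 (vecNorm_nonneg _) (by positivity)
  have h8 := mul_le_mul_of_nonneg_left h6 hσ.le
  linarith

/-! ### Block rows and singular values -/

section Blocks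

variable {m s : ℕ}

theorem blockRow_mulVec (k : ℕ) (X : ℕ → Matrix (Fin m) (Fin s) ℝ) (f : ℕ → Fin s → ℝ) :
    blockRow k X *ᵥ (fun c => f c.1 c.2) = ∑ i ∈ Finset.range k, X i *ᵥ f i := by
  ext r
  simp only [Matrix.mulVec, dotProduct, blockRow, Matrix.of_apply, Fintype.sum_prod_type,
    Finset.sum_apply]
  exact Fin.sum_univ_eq_sum_range (fun i => ∑ a, X i r a * f i a) k

theorem vecNorm_sq_block (k : ℕ) (f : ℕ → Fin s → ℝ) :
    vecNorm (fun c : Fin k × Fin s => f c.1 c.2) ^ 2 =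
      ∑ i ∈ Finset.range k, vecNorm (f i) ^ 2 := by
  simp only [vecNorm_sq, dotProduct, Fintype.sum_prod_type]
  exact Fin.sum_univ_eq_sum_range (fun i => ∑ a, f i a * f i a) k

theorem blockRow_mul_blockCol (k : ℕ) (Q : ℕ → Matrix (Fin m) (Fin s) ℝ)
    (B : ℕ → Matrix (Fin s) (Fin s) ℝ) :
    blockRow k Q * blockCol k B = ∑ i ∈ Finset.range k, Q i * B i := by
  ext r b
  simp only [Matrix.mul_apply, blockRow, blockCol, Matrix.of_apply, Fintype.sum_prod_type,
    Matrix.sum_apply]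
  exact Fin.sum_univ_eq_sum_range (fun i => ∑ a, Q i r a * B i a b) k

theorem blockRow_mul_blockMat_apply (k : ℕ) (Q : ℕ → Matrix (Fin m) (Fin s) ℝ)
    (R : ℕ → ℕ → Matrix (Fin s) (Fin s) ℝ) (r : Fin m) (c : Fin k × Fin s) :
    (blockRow k Q * blockMat k R) r c = (∑ i ∈ Finset.range k, Q i * R i c.1) r c.2 := by
  rw [← blockRow_mul_blockCol]
  rfl

theorem sigmaMin_mul_vecNorm_le {m n : Type*} [Fintype m] [Fintype n] [DecidableEq n]
    (A : Matrix m n ℝ) (v : n → ℝ) : sigmaMin A * vecNorm v ≤ vecNorm (A *ᵥ v) := by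
  rcases (vecNorm_nonneg v).eq_or_lt with h0 | h0
  · rw [← h0, mul_zero]; exact vecNorm_nonneg _
  · have hb : BddBelow (Set.range fun v : Metric.sphere (0 : EuclideanSpace ℝ n) 1 =>
        ‖Matrix.toEuclideanLin A v.1‖) := ⟨0, by rintro _ ⟨v, rfl⟩; exact norm_nonneg _⟩
    set x : EuclideanSpace ℝ n := WithLp.toLp 2 v with hx
    have hx0 : 0 < ‖x‖ := h0
    have h1 := ciInf_le hb ⟨‖x‖⁻¹ • x, by
      rw [mem_sphere_zero_iff_norm, norm_smul, norm_inv, norm_norm, inv_mul_cancel₀ hx0.ne']⟩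
    simp only [map_smul, norm_smul, norm_inv, norm_norm] at h1
    change sigmaMin A ≤ ‖x‖⁻¹ * vecNorm (A *ᵥ v) at h1
    change sigmaMin A * ‖x‖ ≤ _
    rwa [inv_mul_eq_div, le_div_iff₀ hx0] at h1

/-- The index type has to be nonempty, as the infimum over an empty sphere is `0`. -/
theorem le_sigmaMin {m n : Type*} [Fintype m] [Fintype n] [DecidableEq n] [Nonempty n]
    {A : Matrix m n ℝ} {σ : ℝ} (h : ∀ v, σ * vecNorm v ≤ vecNorm (A *ᵥ v)) : σ ≤ sigmaMin A := by
  have : Nonempty (Metric.sphere (0 : EuclideanSpace ℝ n) 1) :=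
    (NormedSpace.sphere_nonempty.2 zero_le_one).to_subtype
  refine le_ciInf fun v => ?_
  have h1 := h v.1.ofLp
  have h2 : vecNorm v.1.ofLp = 1 := mem_sphere_zero_iff_norm.1 v.2
  rw [h2, mul_one] at h1
  exact h1

theorem sigmaMin_le_norm {m n : Type*} [Fintype m] [Fintype n] [DecidableEq n] [Nonempty n]
    (A : Matrix m n ℝ) : sigmaMin A ≤ ‖A‖ := by
  obtain ⟨j⟩ := ‹Nonempty n›
  have h0 : 0 < vecNorm (Pi.single j 1 : n → ℝ) := by
    have h1 := vecNorm_sq (Pi.single j 1 : n → ℝ)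
    rw [dotProduct_single, Pi.single_eq_same, mul_one] at h1
    by_contra hne
    have h2 := le_antisymm (not_lt.1 hne) (vecNorm_nonneg _)
    norm_num [h2] at h1
  exact le_of_mul_le_mul_right
    ((sigmaMin_mul_vecNorm_le A _).trans (vecNorm_mulVec_le A _)) h0

/-- A single block acts like the block row on a vector with one nonzero block. -/
theorem exists_block_extension {k i : ℕ} (hi : i < k) (X : ℕ → Matrix (Fin m) (Fin s) ℝ)
    (w : Fin s → ℝ) : ∃ f : Fin k × Fin s → ℝ, vecNorm f = vecNorm w ∧
      blockRow k X *ᵥ f = X i *ᵥ w := by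
  refine ⟨fun c => (Pi.single i w : ℕ → Fin s → ℝ) c.1 c.2, ?_, ?_⟩
  · refine (sq_eq_sq₀ (vecNorm_nonneg _) (vecNorm_nonneg _)).1 ?_
    rw [vecNorm_sq_block, Finset.sum_eq_single i]
    · rw [Pi.single_eq_same]
    · intro l _ hl
      rw [Pi.single_eq_of_ne hl, vecNorm_sq, dotProduct_zero]
    · simp [hi]
  · rw [blockRow_mulVec, Finset.sum_eq_single i]
    · rw [Pi.single_eq_same]
    · intro l _ hl
      rw [Pi.single_eq_of_ne hl, Matrix.mulVec_zero]
    · simp [hi]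

theorem norm_block_le {k i : ℕ} (hi : i < k) (X : ℕ → Matrix (Fin m) (Fin s) ℝ) :
    ‖X i‖ ≤ ‖blockRow k X‖ := by
  refine norm_le_of_vecNorm _ (norm_nonneg _) fun w => ?_
  obtain ⟨f, hf, hX⟩ := exists_block_extension hi X w
  rw [← hX, ← hf]
  exact vecNorm_mulVec_le _ _

theorem sigmaMin_le_sigmaMin_block (hs : 0 < s) {k i : ℕ} (hi : i < k)
    (X : ℕ → Matrix (Fin m) (Fin s) ℝ) : sigmaMin (blockRow k X) ≤ sigmaMin (X i) := by
  have : Nonempty (Fin s) := ⟨⟨0, hs⟩⟩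
  refine le_sigmaMin fun w => ?_
  obtain ⟨f, hf, hX⟩ := exists_block_extension hi X w
  rw [← hX, ← hf]
  exact sigmaMin_mul_vecNorm_le _ _

/-- The singular values of `[X₀, …, X_j]` are at least those of the longer `[X₀, …, X_{k-1}]`. -/
theorem sigmaMin_mul_sqrt_le {j k : ℕ} (hj : j < k) (X : ℕ → Matrix (Fin m) (Fin s) ℝ)
    (z : Fin j × Fin s → ℝ) (w : Fin s → ℝ) :
    sigmaMin (blockRow k X) * √(vecNorm z ^ 2 + vecNorm w ^ 2) ≤
      vecNorm (blockRow j X *ᵥ z + X j *ᵥ w) := by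
  -- The vector `(z, w)` is padded with zero blocks.
  set f : ℕ → Fin s → ℝ := fun i a =>
    if h : i < j then z (⟨i, h⟩, a) else if i = j then w a else 0 with hf
  have hz : z = fun c : Fin j × Fin s => f c.1 c.2 := by
    ext ⟨c, a⟩
    simp [hf]
  have hw : f j = w := by ext a; simp [hf]
  have h0 : ∀ i, j < i → f i = 0 := by
    intro i hi
    ext a
    simp [hf, hi.not_gt, hi.ne']
  have hsub : Finset.range (j + 1) ⊆ Finset.range k := Finset.range_subset_range.2 hj
  have h1 : vecNorm (fun c : Fin k × Fin s => f c.1 c.2) = √(vecNorm z ^ 2 + vecNorm w ^ 2) := by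
    rw [eq_comm, Real.sqrt_eq_iff_eq_sq (by positivity) (vecNorm_nonneg _), hz, vecNorm_sq_block,
      vecNorm_sq_block, ← Finset.sum_subset hsub, Finset.sum_range_succ, hw]
    intro i _ hi
    rw [h0 i (by simpa using hi), vecNorm_sq, dotProduct_zero]
  have h2 : blockRow k X *ᵥ (fun c => f c.1 c.2) = blockRow j X *ᵥ z + X j *ᵥ w := by
    rw [hz, blockRow_mulVec, blockRow_mulVec, ← Finset.sum_subset hsub, Finset.sum_range_succ, hw]
    intro i _ hi
    rw [h0 i (by simpa using hi), Matrix.mulVec_zero]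
  rw [← h1, ← h2]
  exact sigmaMin_mul_vecNorm_le _ _

end Blocks

/-! ### Induction over the blocks -/

section Induction

variable {m s : ℕ}

/-- The state of a run after `j` blocks, up to the error `ε`: the blocks of `Q` are orthonormal,
they factor `X` with the coefficients `R`, and for `j < k` the next column `S` of coefficients has
been obtained. Errors are measured entrywise; `N` is the scale of `X`. -/
structure Accurate (k : ℕ) (X Q : ℕ → Matrix (Fin m) (Fin s) ℝ)
    (R S : ℕ → ℕ → Matrix (Fin s) (Fin s) ℝ) (N ε : ℝ) (j : ℕ) : Prop where
  orth : ∀ i < j, ∀ l < j, ∀ a b,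
    |((if i = l then 1 else 0 : Matrix (Fin s) (Fin s) ℝ) - (Q i)ᵀ * Q l) a b| ≤ ε
  residual : ∀ l < j, ∀ r b, |(X l - ∑ i ∈ Finset.range j, Q i * R i l) r b| ≤ ε * N
  coeff : j < k → ∀ i < j, ∀ a b, |(S i j - (Q i)ᵀ * X j) a b| ≤ ε * N

variable {k D : ℕ} {X Q : ℕ → Matrix (Fin m) (Fin s) ℝ} {R S : ℕ → ℕ → Matrix (Fin s) (Fin s) ℝ}
  {N ε : ℝ} {j : ℕ}

theorem norm_le_of_entries {m n : Type*} [Fintype m] [Fintype n] [DecidableEq n]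
    (hm : Fintype.card m ≤ D) (hn : Fintype.card n ≤ D) {A : Matrix m n ℝ} {b : ℝ} (hb : 0 ≤ b)
    (h : ∀ i j, |A i j| ≤ b) : ‖A‖ ≤ (D : ℝ) ^ 2 * b := by
  refine (norm_le_of_abs_apply_le A h).trans (mul_le_mul_of_nonneg_right ?_ hb)
  rw [sq]; gcongr

theorem Accurate.norm_orth_le (h : Accurate k X Q R S N ε j) (hj : j * s ≤ D) (hε : 0 ≤ ε) :
    ‖1 - (blockRow j Q)ᵀ * blockRow j Q‖ ≤ (D : ℝ) ^ 2 * ε := by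
  refine norm_le_of_entries (by simpa using hj) (by simpa using hj) hε fun c d => ?_
  refine le_of_eq_of_le ?_ (h.orth c.1 c.1.2 d.1 d.1.2 c.2 d.2)
  congr 1
  rw [Matrix.sub_apply, Matrix.sub_apply]
  congr 1
  obtain ⟨c, a⟩ := c
  obtain ⟨d, b⟩ := d
  by_cases hcd : c = d
  · subst hcd
    simp [Matrix.one_apply]
  · have : (c : ℕ) ≠ d := fun h => hcd (Fin.ext h)
    simp [hcd, this]

theorem Accurate.norm_residual_le (h : Accurate k X Q R S N ε j) (hm : m ≤ D) (hj : j * s ≤ D)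
    (hε : 0 ≤ ε) (hN : 0 ≤ N) :
    ‖blockRow j X - blockRow j Q * blockMat j R‖ ≤ (D : ℝ) ^ 2 * ε * N := by
  rw [mul_assoc]
  refine norm_le_of_entries (by simpa using hm) (by simpa using hj) (by positivity) fun r c => ?_
  refine le_of_eq_of_le ?_ (h.residual c.1 c.1.2 r c.2)
  rw [Matrix.sub_apply, Matrix.sub_apply, blockRow_mul_blockMat_apply]
  rfl

theorem Accurate.norm_coeff_le (h : Accurate k X Q R S N ε j) (hs : s ≤ D) (hj : j * s ≤ D)
    (hε : 0 ≤ ε) (hN : 0 ≤ N) (hjk : j < k) :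
    ‖blockCol j (fun i => S i j) - (blockRow j Q)ᵀ * X j‖ ≤ (D : ℝ) ^ 2 * ε * N := by
  rw [mul_assoc]
  exact norm_le_of_entries (by simpa using hj) (by simpa using hs) (by positivity) fun c b =>
    h.coeff hjk c.1 c.1.2 c.2 b

/-- One step of the method: the errors grow by a constant factor. -/
theorem IsRun.accurate_succ {p : ℕ} {u : ℝ}
    {orth : Matrix (Fin m) (Fin s) ℝ → Matrix (Fin m) (Fin s) ℝ × Matrix (Fin s) (Fin s) ℝ}
    {U : ℕ → Matrix (Fin m) (Fin s) ℝ} {Y Z : ℕ → ℕ → Matrix (Fin s) (Fin s) ℝ}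
    {T Ω P : ℕ → Matrix (Fin s) (Fin s) ℝ} (h : IsRun u orth p X Q U R S Y Z T Ω P)
    (hu : 0 ≤ u) (hD : 1 ≤ D) (hm : m ≤ D) (hs : s ≤ D) (hps : p * s ≤ D) (hkp : k ≤ p)
    {κ κ' σ : ℝ} (hκ : 0 ≤ κ) (hκ' : κ' = 10 ^ 4 * ((D : ℝ) ^ 2 * κ + 2 * projConst D))
    (hj1 : 1 ≤ j) (hjk : j < k) (hN : ∀ i < k, ‖X i‖ ≤ N)
    (hσ : 0 < σ) (hσN : σ ≤ N) (hsmall : 100 * (κ' * u * N ^ 2) ≤ σ ^ 2)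
    (hLB : ∀ z w, σ * √(vecNorm z ^ 2 + vecNorm w ^ 2) ≤
      vecNorm (blockRow j X *ᵥ z + X j *ᵥ w))
    (hacc : Accurate k X Q R S N (κ * u) j) : Accurate k X Q R S N (κ' * u) (j + 1) := by
  have hjp : j < p := hjk.trans_le hkp
  have hN0 : 0 < N := hσ.trans_le hσN
  have hD2 : (1 : ℝ) ≤ (D : ℝ) ^ 2 := one_le_pow₀ (by exact_mod_cast hD)
  have hq : Fintype.card (Fin j × Fin s) ≤ D := by
    simpa using (Nat.mul_le_mul_right s hjp.le).trans hps
  have hjs : j * s ≤ D := (Nat.mul_le_mul_right s hjp.le).trans hps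
  have hs' : Fintype.card (Fin s) ≤ D := by simpa using hs
  have hm' : Fintype.card (Fin m) ≤ D := by simpa using hm
  set ε := ((D : ℝ) ^ 2 * κ + 2 * projConst D) * u with hε
  have hκε : κ' * u = 10 ^ 4 * ε := by rw [hκ', hε]; ring
  have hκu : 0 ≤ κ * u := mul_nonneg hκ hu
  have hδ0 : 0 ≤ matConst D * u := mul_nonneg (matConst_nonneg D) hu
  have hδP := mul_le_mul_of_nonneg_right (matConst_le_projConst hD) hu
  have hDκ : κ * u ≤ (D : ℝ) ^ 2 * (κ * u) := by
    have := mul_le_mul_of_nonneg_right hD2 hκu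
    linarith
  have hε' : ε = (D : ℝ) ^ 2 * (κ * u) + 2 * (projConst D * u) := by rw [hε]; ring
  have hδε : 1000 * (matConst D * u) ≤ ε := by linarith
  have hDκε : (D : ℝ) ^ 2 * (κ * u) ≤ ε := by linarith
  have hε0 : 0 ≤ ε := by linarith
  have hsm : 10 ^ 6 * (ε * N ^ 2) ≤ σ ^ 2 := by rw [hκε] at hsmall; linarith
  have hσN2 : σ ^ 2 ≤ N ^ 2 := pow_le_pow_left₀ hσ.le hσN 2
  have hε1 : 10 ^ 6 * ε ≤ 1 := by
    have h1 : 10 ^ 6 * ε * N ^ 2 ≤ 1 * N ^ 2 := by linarith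
    exact le_of_mul_le_mul_right h1 (by positivity)
  have hu1 : u ≤ 1 := by
    have := mul_le_mul_of_nonneg_right (one_le_matConst hD) hu
    linarith
  have hεN : 0 ≤ ε * N := by positivity
  have horth := hacc.norm_orth_le hjs hκu
  have hres := hacc.norm_residual_le hm hjs hκu hN0.le
  have hcoef := hacc.norm_coeff_le hs hjs hκu hN0.le hjk
  have hd : (D : ℝ) ^ 2 * (κ * u) * N ≤ σ / 2 := by
    have h1 : ε * N * N ≤ σ / 2 * N := by
      have h2 : σ * σ ≤ σ * N := mul_le_mul_of_nonneg_left hσN hσ.le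
      have h3 : 0 ≤ σ * N := by positivity
      linarith
    exact (mul_le_mul_of_nonneg_right hDκε hN0.le).trans (le_of_mul_le_mul_right h1 hN0)
  have hV := quadLB_projection hσ hLB hres hd ((blockRow j Q)ᵀ * X j)
  have hXj := hN j hjk
  obtain ⟨H, hH, hR⟩ := h.S_diag j hj1 hjp
  obtain ⟨V, hVf, hU⟩ := h.first_proj j hj1 hjp
  obtain ⟨K, hK, hR'⟩ := h.Y_diag j hj1 hjp
  obtain ⟨W, hW, hQ'⟩ := h.second_proj j hj1 hjp
  obtain ⟨⟨hdiag, hΘ8, hΘLB⟩, ⟨hU2, hR4, hS3, hY6⟩, ⟨hUR, hQR⟩, hQQ, hQQ'⟩ :=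
    fl_two_projections (κ := (D : ℝ) ^ 2 * κ) hD hm hs hq hu hε hε1 hσ hsm
      (horth.trans_eq (by ring)) hXj (hcoef.trans_eq (by ring)) hV (h.gram_X j hj1 hjp) hH hR hVf hU
      (h.sync_Y j hj1 hjp) (h.sync_Ω j hj1 hjp) hK hR' hW hQ'
  have hQ2 := norm_le_two_of_orth horth (by linarith)
  have hQ'2 := norm_le_two_of_orth hQQ (by linarith)
  have hold : κ * u ≤ 10 ^ 4 * ε := by linarith
  rw [hκε]
  refine ⟨?_, ?_, ?_⟩
  · intro i hi l hl a b
    rcases Nat.lt_succ_iff_lt_or_eq.1 hi with hi | rfl <;>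
      rcases Nat.lt_succ_iff_lt_or_eq.1 hl with hl | rfl
    · exact (hacc.orth i hi l hl a b).trans hold
    · have h1 := (abs_apply_le_norm ((blockRow l Q)ᵀ * Q l) (⟨i, hi⟩, a) b).trans hQQ'
      rw [if_neg hi.ne, zero_sub, Matrix.neg_apply, abs_neg]
      exact le_trans h1 (by linarith)
    · have h1 := (abs_apply_le_norm ((blockRow i Q)ᵀ * Q i) (⟨l, hl⟩, b) a).trans hQQ'
      have h2 : ((Q i)ᵀ * Q l) a b = ((Q l)ᵀ * Q i) b a := by
        rw [← Matrix.transpose_apply ((Q l)ᵀ * Q i), Matrix.transpose_mul,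
          Matrix.transpose_transpose]
      rw [if_neg hl.ne', zero_sub, Matrix.neg_apply, abs_neg, h2]
      exact le_trans h1 (by linarith)
    · rw [if_pos rfl]
      exact (abs_apply_le_norm _ a b).trans (by linarith)
  · intro l hl r b
    rw [Finset.sum_range_succ]
    rcases Nat.lt_succ_iff_lt_or_eq.1 hl with hl | rfl
    · rw [h.R_lower j l hl hjp, Matrix.mul_zero, add_zero]
      exact (hacc.residual l hl r b).trans (mul_le_mul_of_nonneg_right hold hN0.le)
    · have h1 := fl_residual_bound hD hs hq hu hδε (by linarith) hQ2 hQ'2 hR4 hΘ8 hS3 hY6 hUR hQR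
        (h.R_upper l hj1 hjp) (h.R_diag l hj1 hjp)
      rw [blockRow_mul_blockCol] at h1
      exact ((abs_apply_le_norm _ r b).trans h1).trans (by linarith)
  · intro hjk' i hi a b
    have hjp' : j + 1 < p := hjk'.trans_le hkp
    have hXj' := hN (j + 1) hjk'
    rcases Nat.lt_succ_iff_lt_or_eq.1 hi with hi | rfl
    · have h1 := (h.sync_Z j hj1 hjp').error_le hq hm' hs' hu hu1
      have h2 : ‖(blockRow j Q)ᵀ‖ * ‖X (j + 1)‖ ≤ 2 * N :=
        mul_le_mul ((norm_transpose _).trans_le hQ2) hXj' (norm_nonneg _) (by norm_num)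
      have h3 := mul_le_mul_of_nonneg_left h2 hδ0
      have h4 := mul_le_mul_of_nonneg_right hδε hN0.le
      rw [h.S_upper j hj1 hjp' i hi]
      refine le_trans (abs_apply_le_norm ((blockCol j fun i => Z i (j + 1)) -
        (blockRow j Q)ᵀ * X (j + 1)) (⟨i, hi⟩, a) b) (h1.trans ?_)
      linarith
    · obtain ⟨J, hJ, hL⟩ := h.S_last i hj1 hjp'
      have h1 := fl_delayed_coefficient_bound hD hm hs hq hu hδε (by linarith) hQ2 hQ'2 hU2 hXj' hΘ8
        hY6 hQR hR'.1 hdiag hΘLB (h.sync_Z i hj1 hjp') (h.sync_P i hj1 hjp') hJ hL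
      exact ((abs_apply_le_norm _ a b).trans h1).trans (by linarith)

/-- The entrywise error constant after `n + 1` blocks. -/
noncomputable def errConst (D : ℕ) (c : ℝ) : ℕ → ℝ
  | 0 => 2 * c + 2 * matConst D
  | n + 1 => 10 ^ 4 * ((D : ℝ) ^ 2 * errConst D c n + 2 * projConst D)

theorem projConst_nonneg (D : ℕ) : 0 ≤ projConst D := by
  have := matConst_nonneg D
  unfold projConst; positivity

theorem errConst_nonneg {c : ℝ} (hc : 0 ≤ c) (n : ℕ) : 0 ≤ errConst D c n := by
  have h1 := matConst_nonneg D
  have h2 := projConst_nonneg D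
  induction n with
  | zero => unfold errConst; positivity
  | succ n ih => unfold errConst; positivity

theorem errConst_mono (hD : 1 ≤ D) {c : ℝ} (hc : 0 ≤ c) : Monotone (errConst D c) := by
  refine monotone_nat_of_le_succ fun n => ?_
  have h1 := projConst_nonneg D
  have h2 := errConst_nonneg (D := D) hc n
  have hD2 : (1 : ℝ) ≤ (D : ℝ) ^ 2 := one_le_pow₀ (by exact_mod_cast hD)
  have h3 := mul_le_mul_of_nonneg_right hD2 h2
  conv_rhs => unfold errConst
  linarith

/-- The first block is orthogonalized by the intra-block routine alone. -/
theorem IsRun.accurate_one {p : ℕ} {u : ℝ}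
    {orth : Matrix (Fin m) (Fin s) ℝ → Matrix (Fin m) (Fin s) ℝ × Matrix (Fin s) (Fin s) ℝ}
    {U : ℕ → Matrix (Fin m) (Fin s) ℝ} {Y Z : ℕ → ℕ → Matrix (Fin s) (Fin s) ℝ}
    {T Ω P : ℕ → Matrix (Fin s) (Fin s) ℝ} (h : IsRun u orth p X Q U R S Y Z T Ω P)
    (hu : 0 ≤ u) (hu1 : u ≤ 1) (hm : m ≤ D) (hs : s ≤ D) (hk : 1 ≤ k) (hkp : k ≤ p)
    {c : ℝ} (hc : 0 ≤ c) (hcu : 2 * (c * u) ≤ 1) (hN : ∀ i < k, ‖X i‖ ≤ N)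
    (hcκ : c * u * condNum (X 0) ^ 2 ≤ 1 / 2)
    (hstab : IOStable c u (X 0) (orth (X 0)).1 (orth (X 0)).2) :
    Accurate k X Q R S N (errConst D c 0 * u) 1 := by
  have hs' : Fintype.card (Fin s) ≤ D := by simpa using hs
  have hm' : Fintype.card (Fin m) ≤ D := by simpa using hm
  rw [← h.first] at hstab
  obtain ⟨-, ⟨E, hE, hEn⟩, hO⟩ := hstab
  have hX0 := hN 0 hk
  have hN0 : 0 ≤ N := (norm_nonneg _).trans hX0
  have hcu0 : 0 ≤ c * u := mul_nonneg hc hu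
  have hδ0 : 0 ≤ matConst D * u := mul_nonneg (matConst_nonneg D) hu
  have he : errConst D c 0 * u = 2 * (c * u) + 2 * (matConst D * u) := by unfold errConst; ring
  have hO' : ‖1 - (Q 0)ᵀ * Q 0‖ ≤ 2 * (c * u) := by
    refine hO.trans ?_
    rw [div_le_iff₀ (by linarith)]
    have := mul_le_mul_of_nonneg_left hcκ hcu0
    linarith
  have hδN : 0 ≤ matConst D * u * N := by positivity
  rw [he]
  refine ⟨?_, ?_, ?_⟩
  · intro i hi l hl a b
    obtain rfl : i = 0 := by omega
    obtain rfl : l = 0 := by omega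
    rw [if_pos rfl]
    exact (abs_apply_le_norm _ a b).trans (by linarith)
  · intro l hl r b
    obtain rfl : l = 0 := by omega
    have h1 : X 0 - ∑ i ∈ Finset.range 1, Q i * R i 0 = -E := by
      rw [Finset.sum_range_one, ← hE]; abel
    have h2 := mul_le_mul_of_nonneg_left hX0 hcu0
    have h3 : 0 ≤ c * u * N := by positivity
    rw [h1, Matrix.neg_apply, abs_neg]
    exact (abs_apply_le_norm E r b).trans (by linarith)
  · intro hk1 i hi a b
    obtain rfl : i = 0 := by omega
    have hX1 := hN 1 hk1
    have h1 := (h.first_S (hk1.trans_le hkp)).error_le hs' hm' hs' hu hu1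
    have h2 : ‖(Q 0)ᵀ‖ * ‖X 1‖ ≤ 2 * N :=
      mul_le_mul ((norm_transpose _).trans_le (norm_le_two_of_orth hO' hcu)) hX1 (norm_nonneg _)
        (by norm_num)
    have h3 := mul_le_mul_of_nonneg_left h2 hδ0
    have h4 : 0 ≤ c * u * N := by positivity
    exact (abs_apply_le_norm _ a b).trans (h1.trans (by linarith))

end Induction

end BlockGS

open BlockGS

theorem mainTheorem1 (m s p : ℕ) (hs : 0 < s) (c : ℝ) (hc : 0 ≤ c) :
    ∃ C : ℝ, 0 < C ∧
      ∀ (u : ℝ), 0 < u →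
      ∀ (orth : Matrix (Fin m) (Fin s) ℝ →
          Matrix (Fin m) (Fin s) ℝ × Matrix (Fin s) (Fin s) ℝ)
        (X Q : ℕ → Matrix (Fin m) (Fin s) ℝ) (R : ℕ → ℕ → Matrix (Fin s) (Fin s) ℝ),
      BlockGS.Computed u orth p X Q R →
      ∀ k : ℕ, 1 ≤ k → k ≤ p →
        0 < BlockGS.sigmaMin (BlockGS.blockRow k X) →
        C * u * BlockGS.condNum (BlockGS.blockRow k X) ^ 2 ≤ 1 / 2 →
        (∀ A : Matrix (Fin m) (Fin s) ℝ, 0 < BlockGS.sigmaMin A →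
          BlockGS.condNum A ≤ BlockGS.condNum (BlockGS.blockRow k X) →
          BlockGS.IOStable c u A (orth A).1 (orth A).2) →
        (∃ E : Matrix (Fin m) (Fin k × Fin s) ℝ,
          BlockGS.blockRow k X + E = BlockGS.blockRow k Q * BlockGS.blockMat k R ∧
          ‖E‖ ≤ C * u * ‖BlockGS.blockRow k X‖) ∧
        ‖1 - (BlockGS.blockRow k Q).transpose * BlockGS.blockRow k Q‖ ≤ C * u := by
  -- `D` exceeds all dimensions that occur.
  set D := m + s + p * s with hDdef
  have hD : 1 ≤ D := by omega
  have hD2 : (1 : ℝ) ≤ (D : ℝ) ^ 2 := one_le_pow₀ (by exact_mod_cast hD)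
  have hK0 := errConst_nonneg (D := D) hc p
  have hDK : errConst D c p ≤ (D : ℝ) ^ 2 * errConst D c p := by
    have := mul_le_mul_of_nonneg_right hD2 hK0
    linarith
  have hcK : 2 * c + 2 * matConst D ≤ errConst D c p := errConst_mono hD hc (Nat.zero_le p)
  have hK1 : 1 ≤ errConst D c p := by linarith [one_le_matConst hD]
  refine ⟨100 * ((D : ℝ) ^ 2 * errConst D c p), by linarith, ?_⟩
  intro u hu orth X Q R ⟨U, S, Y, Z, T, Ω, P, hrun⟩ k hk1 hkp hσ hsmall hstab
  have : Nonempty (Fin k × Fin s) := ⟨(⟨0, hk1⟩, ⟨0, hs⟩)⟩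
  set N := ‖blockRow k X‖ with hNdef
  set σ := sigmaMin (blockRow k X) with hσdef
  have hσN : σ ≤ N := sigmaMin_le_norm _
  have hN0 : 0 < N := hσ.trans_le hσN
  have hcond : condNum (blockRow k X) = N / σ := rfl
  have hκ1 : 1 ≤ condNum (blockRow k X) := by rw [hcond]; exact (one_le_div hσ).2 hσN
  have hκ2 : 1 ≤ condNum (blockRow k X) ^ 2 := one_le_pow₀ hκ1
  have hN : ∀ i < k, ‖X i‖ ≤ N := fun i hi => norm_block_le hi X
  have hKu : u ≤ errConst D c p * u := by
    have := mul_le_mul_of_nonneg_right hK1 hu.le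
    linarith
  have hDKu := mul_le_mul_of_nonneg_right hDK hu.le
  have hbig : 200 * (errConst D c p * u * N ^ 2) ≤ σ ^ 2 := by
    have h1 : 100 * (errConst D c p * u) * condNum (blockRow k X) ^ 2 ≤ 1 / 2 :=
      (mul_le_mul_of_nonneg_right (by linarith) (by positivity)).trans hsmall
    rw [hcond, div_pow, mul_div_assoc', div_le_iff₀ (by positivity)] at h1
    linarith
  have hKu1 : 100 * (errConst D c p * u) ≤ 1 / 2 := by
    have h1 : 100 * (errConst D c p * u) * 1 ≤ _ := mul_le_mul_of_nonneg_left hκ2 (by positivity)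
    have h2 : 100 * (errConst D c p * u) * condNum (blockRow k X) ^ 2 ≤ 1 / 2 :=
      (mul_le_mul_of_nonneg_right (by linarith) (by positivity)).trans hsmall
    linarith
  have hcu : 2 * (c * u) ≤ errConst D c p * u := by
    have := mul_le_mul_of_nonneg_right hcK hu.le
    linarith [mul_nonneg (matConst_nonneg D) hu.le]
  -- The first block inherits the condition of `[X₀, …, X_{k-1}]`.
  have hσ0 : σ ≤ sigmaMin (X 0) := sigmaMin_le_sigmaMin_block hs hk1 X
  have hκ0 : condNum (X 0) ≤ condNum (blockRow k X) :=
    div_le_div₀ hN0.le (hN 0 hk1) hσ hσ0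
  have hκ00 : 0 ≤ condNum (X 0) := div_nonneg (norm_nonneg _) (hσ.le.trans hσ0)
  have hcκ : c * u * condNum (X 0) ^ 2 ≤ 1 / 2 := by
    refine le_trans (mul_le_mul ?_ (pow_le_pow_left₀ hκ00 hκ0 2) (by positivity) ?_) hsmall
    · linarith
    · positivity
  have hacc : ∀ j, j < k → Accurate k X Q R S N (errConst D c j * u) (j + 1) := by
    intro j
    induction j with
    | zero =>
      intro _
      exact hrun.accurate_one hu.le (by linarith) (by omega) (by omega) hk1 hkp hc (by linarith) hN
        hcκ (hstab (X 0) (hσ.trans_le hσ0) hκ0)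
    | succ j ih =>
      intro hj
      have hKj : errConst D c (j + 1) ≤ errConst D c p := errConst_mono hD hc (by omega)
      have h1 : errConst D c (j + 1) * u * N ^ 2 ≤ errConst D c p * u * N ^ 2 := by gcongr
      have h2 : 0 ≤ errConst D c p * u * N ^ 2 := by positivity
      exact hrun.accurate_succ hu.le hD (by omega) (by omega) (by omega) hkp
        (errConst_nonneg hc j) rfl (by omega) hj hN hσ hσN (by linarith)
        (fun z w => sigmaMin_mul_sqrt_le hj X z w) (ih (by omega))
  have hlast := hacc (k - 1) (by omega)
  rw [Nat.sub_add_cancel hk1] at hlast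
  have hKk : errConst D c (k - 1) * u ≤ errConst D c p * u :=
    mul_le_mul_of_nonneg_right (errConst_mono hD hc (by omega)) hu.le
  have hKk0 : 0 ≤ errConst D c (k - 1) * u := mul_nonneg (errConst_nonneg hc _) hu.le
  have hks : k * s ≤ D := (Nat.mul_le_mul_right s hkp).trans (by omega)
  have hC : (D : ℝ) ^ 2 * (errConst D c (k - 1) * u) ≤
      100 * ((D : ℝ) ^ 2 * errConst D c p) * u := by
    have h1 := mul_le_mul_of_nonneg_left hKk (zero_le_one.trans hD2)
    have h2 : 0 ≤ (D : ℝ) ^ 2 * (errConst D c p * u) := by positivity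
    linarith
  refine ⟨⟨blockRow k Q * blockMat k R - blockRow k X, by abel, ?_⟩, ?_⟩
  · rw [norm_sub_rev]
    exact (hlast.norm_residual_le (by omega) hks hKk0 hN0.le).trans
      (mul_le_mul_of_nonneg_right hC hN0.le)
  · exact (hlast.norm_orth_le hks hKk0).trans hC
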